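/- Throughout, "meromorphic" means meromorphic on all of $\mathbb{C}$, and identities between meromorphic functions are understood outside a closed discrete set of points. A meromorphic function $f$ is called differentially algebraic over $\mathbb{C}(z)$ if there are $n\ge 0$ and a nonzero polynomial $P(y_0,\dots,y_n)$ with coefficients in the field $\mathbb{C}(z)$ of complex rational functions such that $P(f,f',\dots,f^{(n)})=0$; otherwise $f$ is called differentially transcendental over $\mathbb{C}(z)$. Then: (1) Every meromorphic function $F$ satisfying $F(z)-F(z-1)=\Gamma(z)$ is differentially transcendental over $\mathbb{C}(z)$. (2) The integral $$K(z)=\int_0^\infty e^{-t}\,\frac{t^z-1}{t-1}\,dt$$ converges absolutely for $\operatorname{Re} z>0$ and has a meromorphic continuation to $\mathbb{C}$. This continuation $K$ (Kurepa's function) satisfies $K(z)-K(z-1)=\Gamma(z)$ and is differentially transcendental over $\mathbb{C}(z)$. (3) The series $$K_1(z)=\sum_{n=0}^\infty \Gamma(z-n)$$ converges absolutely for every $z\in\mathbb{C}\setminus\mathbb{Z}$ and defines a meromorphic function, which satisfies $K_1(z)-K_1(z-1)=\Gamma(z)$ and is differentially transcendental over $\mathbb{C}(z)$. (4) The integral $$A(z)=\int_0^\infty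 e^{-t}\,\frac{t^{z+1}-(-1)^z t}{t+1}\,dt,\qquad (-1)^z=e^{\pi i z},$$ converges absolutely for $\operatorname{Re} z>0$ and has a meromorphic continuation to $\mathbb{C}$. This continuation $A$ (the alternating Kurepa function) is differentially transcendental over $\mathbb{C}(z)$. (5) The series $$A_1(z)=\sum_{n=0}^\infty (-1)^n\,\Gamma(z+1-n)$$ converges absolutely for every $z\in\mathbb{C}\setminus\mathbb{Z}$ and defines a meromorphic function, which is differentially transcendental over $\mathbb{C}(z)$. -/

import Mathlib

open MeasureTheory Filter

noncomputable section

/-- The value at `z` of the differential expression `P(f, f', f'', …)`, where `P` is a differential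
polynomial over `ℂ(z)`: a polynomial in the variables `X₀, X₁, X₂, …` with coefficients in the field
of rational functions, the variable `Xᵢ` standing for the `i`-th derivative. -/
def diffPolyEval (P : MvPolynomial ℕ (RatFunc ℂ)) (f : ℂ → ℂ) (z : ℂ) : ℂ :=
  ∑ m ∈ P.support, (P.coeff m).eval (RingHom.id ℂ) z * m.prod fun i k => iteratedDeriv i f z ^ k

/-- `f` is differentially algebraic over `ℂ(z)`: some nonzero differential polynomial over `ℂ(z)`
vanishes at `f`. For meromorphic `f`, an identity between meromorphic functions
means equality outside a closed discrete set of points. -/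
def IsDiffAlgebraic (f : ℂ → ℂ) : Prop :=
  ∃ P : MvPolynomial ℕ (RatFunc ℂ), P ≠ 0 ∧ ∀ᶠ z in codiscrete ℂ, diffPolyEval P f z = 0

/-- `f` is differentially transcendental over `ℂ(z)` (used for meromorphic `f`). -/
def IsDiffTranscendental (f : ℂ → ℂ) : Prop := ¬ IsDiffAlgebraic f

/-- `F` is a meromorphic function on `ℂ` that satisfies `F(z) - F(z-1) = Γ(z)`. -/
def IsKurepaSolution (F : ℂ → ℂ) : Prop :=
  Meromorphic F ∧ ∀ᶠ z in codiscrete ℂ, F z - F (z - 1) = Complex.Gamma z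

/-- `F` is meromorphic on `ℂ` and agrees with `f` on the half-plane `Re z > 0`. -/
def IsMeromorphicContinuation (f F : ℂ → ℂ) : Prop :=
  Meromorphic F ∧ ∀ z : ℂ, 0 < z.re → F z = f z

/-- The integrand of Kurepa's function. -/
def kurepaIntegrand (z : ℂ) (t : ℝ) : ℂ :=
  Complex.exp (-(t : ℂ)) * (((t : ℂ) ^ z - 1) / ((t : ℂ) - 1))

/-- Kurepa's function on `Re z > 0`. -/
def kurepaIntegral (z : ℂ) : ℂ := ∫ t in Set.Ioi (0 : ℝ), kurepaIntegrand z t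

/-- The series `∑ Γ(z - n)`. -/
def kurepaSeries (z : ℂ) : ℂ := ∑' n : ℕ, Complex.Gamma (z - n)

/-- The integrand of the alternating Kurepa function; `(-1)^z` is the principal
value `exp(π i z)`. -/
def altKurepaIntegrand (z : ℂ) (t : ℝ) : ℂ :=
  Complex.exp (-(t : ℂ)) * (((t : ℂ) ^ (z + 1) - (-1) ^ z * (t : ℂ)) / ((t : ℂ) + 1))

/-- The alternating Kurepa function on `Re z > 0`. -/
def altKurepaIntegral (z : ℂ) : ℂ := ∫ t in Set.Ioi (0 : ℝ), altKurepaIntegrand z t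

/-- The series `∑ (-1)ⁿ Γ(z + 1 - n)`. -/
def altKurepaSeries (z : ℂ) : ℂ := ∑' n : ℕ, (-1) ^ n * Complex.Gamma (z + 1 - n)

end

/-!
Suppose `F` is a meromorphic function with `F(z + 1) + ε F(z) = q(z) Γ(z)`, where `ε` is a constant
and `q` a nonzero polynomial, and suppose that `F` is differentially algebraic over `ℂ(z)`. Then
all derivatives of `F` are algebraic over a finitely generated extension of `ℂ(z)`, and the same
holds for `F(z + 1)`. The algebraic closure of the extension generated by both, inside the field of
meromorphic functions, is stable under differentiation
(`Derivation.algebraicClosure_adjoin_stable`), contains `Γ`, and has finite transcendence degree. So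
it suffices to prove Hölder's theorem in the form that no such differential field contains `Γ`
(`MeromorphicGerm.gamma_notMem`).

A differential field that contains `Γ` contains `ψ = Γ'/Γ` and its derivatives, and these are
algebraically independent over `ℂ(z)`. Indeed `ψ(z + 1) = ψ(z) + 1/z`, and a theorem of Ostrowski's
type (`exists_linear_relation_of_not_algebraicIndependent`) turns an algebraic relation between
functions `yᵢ` with `yᵢ(z + 1) = yᵢ(z) + bᵢ(z)` into a linear one: there are shift invariant
rational functions `cᵢ`, not all zero, and a rational function `g` with
`∑ cᵢ(z) bᵢ(z) = g(z) - g(z + 1)`. For `bᵢ` the `i`-th derivative of `1/z` this is impossible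
(`not_exists_linear_relation_ratFunc`): the left-hand side has a pole at `0` and at no other
integer, so `g`, which is regular far to the left and far to the right, would be regular at all
integers.

The remaining assertions are analytic. The integrals are holomorphic on the right half-plane, and
they continue to the left by means of their difference equations
(`exists_meromorphicContinuation`); by the identity theorem these equations persist for every
continuation. By the reflection formula the series `∑ εⁿ Γ(z - n)` is `π / sin (π z)` times the
entire function `∑ (-ε)ⁿ / Γ(n + 1 - z)` (`gammaSeries_eq`).

Meromorphic functions are treated as elements of a field, `MeromorphicGerm`: germs along the filter
`codiscrete ℂ`.
-/

/-! ### Algebraic closures of differential fields -/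

section DifferentialClosure

variable {K L : Type*} [Field K] [Field L] [Algebra K L]

/-- The chain rule for `D (p(x))`, up to the terms where `D` falls on the coefficients of `p`. -/
lemma Derivation.apply_aeval_sub_mem (D : Derivation ℤ L L) (E : IntermediateField K L)
    (A : IntermediateField E L) (hE : ∀ e ∈ E, D e ∈ A) {x : L} (hx : x ∈ A)
    (p : Polynomial E) :
    D (Polynomial.aeval x p) - Polynomial.aeval x (Polynomial.derivative p) * D x ∈ A := by
  induction p using Polynomial.induction_on' with
  | add p q hp hq =>
    have := add_mem hp hq
    simp only [map_add, add_mul]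
    convert this using 1
    ring
  | monomial n a =>
    have : D (Polynomial.aeval x (Polynomial.monomial n a)) -
        Polynomial.aeval x (Polynomial.derivative (Polynomial.monomial n a)) * D x
        = x ^ n * D (algebraMap E L a) := by
      have hn : algebraMap E L (n : E) = n := _root_.map_natCast (algebraMap E L) n
      simp only [Polynomial.aeval_monomial, Derivation.leibniz, Derivation.leibniz_pow,
        Polynomial.derivative_monomial, map_mul, smul_eq_mul, nsmul_eq_mul, hn]
      ring
    rw [this]
    exact mul_mem (pow_mem hx n) (hE _ a.2)

/-- If `D` maps `E` into its algebraic closure in `L`, then it preserves this closure. -/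
lemma Derivation.algebraicClosure_stable [CharZero L] (D : Derivation ℤ L L)
    (E : IntermediateField K L)
    (hE : ∀ e ∈ E, D e ∈ algebraicClosure E L) {x : L} (hx : x ∈ algebraicClosure E L) :
    D x ∈ algebraicClosure E L := by
  have hxi : IsIntegral E x := (mem_algebraicClosure_iff.1 hx).isIntegral
  have hsep : (minpoly E x).Separable := (minpoly.irreducible hxi).separable
  have h0 := hsep.aeval_derivative_ne_zero (minpoly.aeval E x)
  have h1 := D.apply_aeval_sub_mem E (algebraicClosure E L) hE hx (minpoly E x)
  rw [minpoly.aeval, map_zero, zero_sub] at h1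
  have h2 : Polynomial.aeval x (Polynomial.derivative (minpoly E x)) ∈ algebraicClosure E L := by
    rw [Polynomial.aeval_eq_sum_range]
    exact sum_mem fun i _ => (algebraicClosure E L).smul_mem (pow_mem hx i)
  have h3 := mul_mem (inv_mem h2) (neg_mem h1)
  rwa [neg_neg, inv_mul_cancel_left₀ h0] at h3

/-- It suffices to test the hypothesis of `Derivation.algebraicClosure_stable` on generators. -/
lemma Derivation.algebraicClosure_adjoin_stable [CharZero L] (D : Derivation ℤ L L)
    (hK : ∀ a : K, D (algebraMap K L a) ∈ (algebraMap K L).range) (S : Set L)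
    (hS : ∀ s ∈ S, D s ∈ algebraicClosure (IntermediateField.adjoin K S) L) {x : L}
    (hx : x ∈ algebraicClosure (IntermediateField.adjoin K S) L) :
    D x ∈ algebraicClosure (IntermediateField.adjoin K S) L := by
  set E := IntermediateField.adjoin K S
  have hEA : ∀ e ∈ E, e ∈ algebraicClosure E L := fun e he =>
    (algebraicClosure E L).algebraMap_mem ⟨e, he⟩
  refine D.algebraicClosure_stable E (fun e he => ?_) hx
  induction he using IntermediateField.adjoin_induction with
  | mem x hx => exact hS x hx
  | algebraMap a =>
    obtain ⟨b, hb⟩ := hK a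
    rw [← hb]
    exact hEA _ (E.algebraMap_mem b)
  | add x y _ _ hx hy => rw [map_add]; exact add_mem hx hy
  | inv x hxE hx =>
    rw [Derivation.leibniz_inv, smul_eq_mul]
    exact mul_mem (neg_mem (pow_mem (inv_mem (hEA x hxE)) 2)) hx
  | mul x y hxE hyE hx hy =>
    rw [Derivation.leibniz, smul_eq_mul, smul_eq_mul]
    exact add_mem (mul_mem (hEA x hxE) hy) (mul_mem (hEA y hyE) hx)

open scoped IntermediateField.algebraAdjoinAdjoin in
lemma mem_algebraicClosure_adjoin_iff {S : Set L} {x : L} :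
    x ∈ algebraicClosure (IntermediateField.adjoin K S) L ↔
      IsAlgebraic (Algebra.adjoin K S) x := by
  rw [mem_algebraicClosure_iff]
  exact (IsFractionRing.isAlgebraic_iff (Algebra.adjoin K S) (IntermediateField.adjoin K S) L).symm

/-- An infinite family in the algebraic closure of a finitely generated extension is algebraically
dependent. -/
lemma not_algebraicIndependent_of_mem_algebraicClosure {S : Set L} (hS : S.Finite) (y : ℕ → L)
    (hy : ∀ i, y i ∈ algebraicClosure (IntermediateField.adjoin K S) L) :
    ¬ AlgebraicIndependent K y := by
  intro h
  let M := AlgebraicIndependent.matroid K L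
  have hI : M.Indep (Set.range y) := AlgebraicIndependent.matroid_indep_iff.2 h.to_subtype_range
  have hcl : Set.range y ⊆ M.closure S := by
    rintro _ ⟨i, rfl⟩
    rw [AlgebraicIndependent.matroid_closure_eq]
    exact mem_algebraicClosure_adjoin_iff.1 (hy i)
  have h1 : (Set.range y).encard ≤ S.encard := by
    rw [← hI.eRk_eq_encard]
    exact (M.eRk_mono hcl).trans ((M.eRk_closure_eq S).le.trans (M.eRk_le_encard S))
  have h2 : (Set.range y).Finite := hS.finite_of_encard_le h1
  exact Set.infinite_range_of_injective h.injective h2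

/-- If the family `y` is algebraically dependent over `K`, then some member is algebraic over the
field generated by its predecessors. -/
lemma exists_mem_algebraicClosure_of_not_algebraicIndependent {y : ℕ → L}
    (h : ¬ AlgebraicIndependent K y) :
    ∃ n, y n ∈ algebraicClosure (IntermediateField.adjoin K (y '' Set.Iio n)) L := by
  by_contra! hn
  have key : ∀ n, AlgebraicIndepOn K y (Set.Iio n) := by
    intro n
    induction n with
    | zero =>
      have : Set.Iio 0 = (∅ : Set ℕ) := by ext; simp
      rw [this]
      exact algebraicIndependent_empty_type_iff.2 (algebraMap K L).injective
    | succ n ih =>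
      have : Set.Iio (n + 1) = insert n (Set.Iio n) := by ext; simp
      rw [this, AlgebraicIndepOn.insert_iff (by simp)]
      exact ⟨ih, fun hh => hn n (mem_algebraicClosure_adjoin_iff.2 hh)⟩
  refine h (algebraicIndependent_of_finite_type fun t ht => ?_)
  obtain ⟨N, hN⟩ := ht.bddAbove
  exact (key (N + 1)).mono fun i hi => Nat.lt_succ_of_le (hN hi)

/-- An element all of whose derivatives satisfy a common algebraic relation lies, with all its
derivatives, in the algebraic closure of a finitely generated extension. -/
lemma exists_finite_differentialClosure (D : Derivation ℤ L L) {f : L}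
    (hf : ¬ AlgebraicIndependent K fun i => D^[i] f) :
    ∃ S : Set L, S.Finite ∧ f ∈ algebraicClosure (IntermediateField.adjoin K S) L ∧
      ∀ s ∈ S, D s ∈ algebraicClosure (IntermediateField.adjoin K S) L := by
  obtain ⟨n, hn⟩ := exists_mem_algebraicClosure_of_not_algebraicIndependent hf
  set S := (fun i => D^[i] f) '' Set.Iio n
  have hSA : ∀ i ≤ n, D^[i] f ∈ algebraicClosure (IntermediateField.adjoin K S) L := by
    intro i hi
    rcases hi.lt_or_eq with hi | rfl
    · exact (algebraicClosure (IntermediateField.adjoin K S) L).algebraMap_mem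
        ⟨D^[i] f, IntermediateField.subset_adjoin K S ⟨i, hi, rfl⟩⟩
    · exact hn
  refine ⟨S, (Set.finite_Iio n).image _, hSA 0 n.zero_le, ?_⟩
  rintro _ ⟨i, hi, rfl⟩
  change D (D^[i] f) ∈ _
  rw [← Function.iterate_succ_apply' (f := D)]
  exact hSA (i + 1) hi

end DifferentialClosure

/-! ### Translations of polynomial rings -/

section Translation

variable {ι K : Type*} [Field K]

/-- The endomorphism of `K[Xᵢ]` that applies `σ` to the coefficients and replaces each variable
`Xᵢ` by `Xᵢ + bᵢ`. -/
noncomputable def twistedTranslation (σ : K →+* K) (b : ι → K) :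
    MvPolynomial ι K →+* MvPolynomial ι K :=
  MvPolynomial.eval₂Hom (MvPolynomial.C.comp σ) fun i => MvPolynomial.X i + MvPolynomial.C (b i)

variable (σ : K →+* K) (b : ι → K)

@[simp] lemma twistedTranslation_C (a : K) :
    twistedTranslation σ b (MvPolynomial.C a) = MvPolynomial.C (σ a) := by
  simp [twistedTranslation]

@[simp] lemma twistedTranslation_X (i : ι) :
    twistedTranslation σ b (MvPolynomial.X i) = MvPolynomial.X i + MvPolynomial.C (b i) := by
  simp [twistedTranslation]

lemma pderiv_twistedTranslation (i : ι) (P : MvPolynomial ι K) :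
    MvPolynomial.pderiv i (twistedTranslation σ b P) =
      twistedTranslation σ b (MvPolynomial.pderiv i P) := by
  classical
  induction P using MvPolynomial.induction_on with
  | C a => simp
  | add p q hp hq => simp only [map_add, hp, hq]
  | mul_X p j hp =>
    simp only [map_mul, twistedTranslation_X, MvPolynomial.pderiv_mul, hp, map_add,
      MvPolynomial.pderiv_X, MvPolynomial.pderiv_C, add_zero]
    by_cases h : j = i
    · subst h; simp
    · simp [h]

/-- The case of a monomial, proved by adding one variable at a time: the support of the image is
bounded in degree, and only lower degrees occur in the difference. -/
lemma twistedTranslation_monomial_degree [DecidableEq ι] (s : Multiset ι) (a : K) :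
    (∀ m ∈ (twistedTranslation σ b (MvPolynomial.monomial (Multiset.toFinsupp s) a)).support,
      m.degree ≤ (Multiset.toFinsupp s).degree) ∧
    (∀ m ∈ (twistedTranslation σ b (MvPolynomial.monomial (Multiset.toFinsupp s) a) -
      MvPolynomial.map σ (MvPolynomial.monomial (Multiset.toFinsupp s) a)).support,
      m.degree < (Multiset.toFinsupp s).degree) := by
  have hX : ∀ (i : ι) (q : MvPolynomial ι K) (m : ι →₀ ℕ),
      m ∈ (MvPolynomial.X i * q).support → ∃ m' ∈ q.support, m.degree = m'.degree + 1 := by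
    intro i q m hm
    rw [MvPolynomial.support_X_mul, Finset.mem_map] at hm
    obtain ⟨m', hm', rfl⟩ := hm
    exact ⟨m', hm', by simp [add_comm]⟩
  have hC : ∀ (c : K) (q : MvPolynomial ι K), (MvPolynomial.C c * q).support ⊆ q.support := by
    intro c q
    rw [MvPolynomial.C_mul']
    exact MvPolynomial.support_smul
  induction s using Multiset.induction_on with
  | empty =>
    have : (MvPolynomial.monomial (Multiset.toFinsupp (0 : Multiset ι)) a) =
        MvPolynomial.C a := by simp
    rw [this, twistedTranslation_C, MvPolynomial.map_C, sub_self]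
    refine ⟨fun m hm => ?_, fun m hm => by simp at hm⟩
    have h1 := MvPolynomial.le_totalDegree hm
    rw [MvPolynomial.totalDegree_C] at h1
    exact h1.trans (Nat.zero_le _)
  | cons i s ih =>
    obtain ⟨ih1, ih2⟩ := ih
    have h1 : MvPolynomial.monomial (Multiset.toFinsupp (i ::ₘ s)) a =
        MvPolynomial.X i * MvPolynomial.monomial (Multiset.toFinsupp s) a := by
      rw [← Multiset.singleton_add, map_add, Multiset.toFinsupp_singleton, MvPolynomial.X,
        MvPolynomial.monomial_mul, one_mul]
    have h2 : (Multiset.toFinsupp (i ::ₘ s)).degree = (Multiset.toFinsupp s).degree + 1 := by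
      rw [← Multiset.singleton_add, map_add, Multiset.toFinsupp_singleton]
      simp [add_comm]
    rw [h1, h2, map_mul, map_mul, twistedTranslation_X, MvPolynomial.map_X]
    set q := twistedTranslation σ b (MvPolynomial.monomial (Multiset.toFinsupp s) a)
    set r := MvPolynomial.map σ (MvPolynomial.monomial (Multiset.toFinsupp s) a)
    constructor
    · intro m hm
      rw [add_mul] at hm
      rcases Finset.mem_union.1 (MvPolynomial.support_add hm) with hm | hm
      · obtain ⟨m', hm', h⟩ := hX _ _ _ hm
        have := ih1 m' hm'
        omega
      · have := ih1 m (hC _ _ hm)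
        omega
    · intro m hm
      have : (MvPolynomial.X i + MvPolynomial.C (b i)) * q - MvPolynomial.X i * r =
          MvPolynomial.X i * (q - r) + MvPolynomial.C (b i) * q := by ring
      rw [this] at hm
      rcases Finset.mem_union.1 (MvPolynomial.support_add hm) with hm | hm
      · obtain ⟨m', hm', h⟩ := hX _ _ _ hm
        have := ih2 m' hm'
        omega
      · have := ih1 m (hC _ _ hm)
        omega

/-- `twistedTranslation σ b` differs from applying `σ` to the coefficients by terms of lower
degree. -/
lemma degree_lt_of_mem_support_twistedTranslation_sub_map (P : MvPolynomial ι K)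
    {m : ι →₀ ℕ} (hm : m ∈ (twistedTranslation σ b P - MvPolynomial.map σ P).support) :
    m.degree < P.totalDegree := by
  classical
  have h1 : twistedTranslation σ b P - MvPolynomial.map σ P =
      ∑ n ∈ P.support, (twistedTranslation σ b (MvPolynomial.monomial n (P.coeff n)) -
        MvPolynomial.map σ (MvPolynomial.monomial n (P.coeff n))) := by
    rw [Finset.sum_sub_distrib, ← map_sum, ← map_sum, ← MvPolynomial.as_sum]
  rw [h1] at hm
  obtain ⟨n, hn, hmn⟩ := Finset.mem_biUnion.1 (MvPolynomial.support_sum hm)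
  have h2 := (twistedTranslation_monomial_degree σ b (Finsupp.toMultiset n) (P.coeff n)).2
  rw [Finsupp.toMultiset_toFinsupp] at h2
  exact (h2 m hmn).trans_le (MvPolynomial.le_totalDegree hn)

end Translation

/-! ### Algebraic relations between solutions of difference equations -/

section Ostrowski

variable {ι K L : Type*} [Field K] [Field L] [Algebra K L]

lemma MvPolynomial.totalDegree_pderiv_lt {P : MvPolynomial ι K} (hP : P.totalDegree ≠ 0) (i : ι) :
    (MvPolynomial.pderiv i P).totalDegree < P.totalDegree := by
  rw [MvPolynomial.totalDegree, Finset.sup_lt_iff (Nat.pos_of_ne_zero hP)]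
  intro m hm
  rw [MvPolynomial.mem_support_iff, MvPolynomial.coeff_pderiv] at hm
  have h1 : m + Finsupp.single i 1 ∈ P.support :=
    MvPolynomial.mem_support_iff.2 (left_ne_zero_of_mul hm)
  have h2 : (m + Finsupp.single i 1).degree ≤ P.totalDegree := MvPolynomial.le_totalDegree h1
  rw [map_add, Finsupp.degree_single] at h2
  exact Nat.lt_of_succ_le h2

lemma MvPolynomial.eq_C_of_pderiv_eq_zero [CharZero K] {P : MvPolynomial ι K}
    (hP : ∀ i, MvPolynomial.pderiv i P = 0) : ∃ r, P = MvPolynomial.C r := by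
  classical
  refine ⟨P.coeff 0, MvPolynomial.ext _ _ fun m => ?_⟩
  rw [MvPolynomial.coeff_C]
  split_ifs with h
  · rw [h]
  · obtain ⟨i, hi⟩ : ∃ i, m i ≠ 0 := by
      by_contra! h'
      exact h (Finsupp.ext fun i => (h' i).symm)
    have h1 := congrArg (MvPolynomial.coeff (m - Finsupp.single i 1)) (hP i)
    have h2 : m - Finsupp.single i 1 + Finsupp.single i 1 = m :=
      tsub_add_cancel_of_le (Finsupp.single_le_iff.2 (Nat.one_le_iff_ne_zero.2 hi))
    rw [MvPolynomial.coeff_pderiv, h2, MvPolynomial.coeff_zero] at h1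
    exact (mul_eq_zero.1 h1).resolve_right (Nat.cast_add_one_ne_zero _)

/-- A nonconstant polynomial fixed by `twistedTranslation σ b` has an iterated partial derivative
that is fixed and of degree one; this yields a linear relation between the `bᵢ`. -/
lemma exists_linear_relation_of_twistedTranslation_eq [CharZero K] (σ : K →+* K) (b : ι → K) :
    ∀ (n : ℕ) (P : MvPolynomial ι K), P.totalDegree = n → n ≠ 0 → twistedTranslation σ b P = P →
    ∃ (s : Finset ι) (c : ι → K) (g : K), (∃ i ∈ s, c i ≠ 0) ∧ (∀ i, σ (c i) = c i) ∧
      ∑ i ∈ s, c i * b i = g - σ g := by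
  classical
  intro n
  induction n using Nat.strong_induction_on with
  | _ n ih =>
    intro P hn hn0 hP
    have hfix : ∀ i, twistedTranslation σ b (MvPolynomial.pderiv i P) = MvPolynomial.pderiv i P :=
      fun i => by rw [← pderiv_twistedTranslation, hP]
    by_cases hd : ∃ i, (MvPolynomial.pderiv i P).totalDegree ≠ 0
    · obtain ⟨i, hi⟩ := hd
      exact ih _ (hn ▸ MvPolynomial.totalDegree_pderiv_lt (hn ▸ hn0) i) _ rfl hi (hfix i)
    · push Not at hd
      have hd' : ∀ i, ∃ c, MvPolynomial.pderiv i P = MvPolynomial.C c := fun i =>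
        ⟨_, MvPolynomial.totalDegree_eq_zero_iff_eq_C.1 (hd i)⟩
      choose c hc using hd'
      have hσ : ∀ i, σ (c i) = c i := by
        intro i
        have := hfix i
        rw [hc, twistedTranslation_C] at this
        exact MvPolynomial.C_injective _ _ this
      obtain ⟨g, hg⟩ := MvPolynomial.eq_C_of_pderiv_eq_zero
        (P := P - ∑ i ∈ P.vars, MvPolynomial.C (c i) * MvPolynomial.X i) (by
          intro j
          simp only [map_sub, map_sum, MvPolynomial.pderiv_C_mul, MvPolynomial.pderiv_X, hc]
          by_cases hj : j ∈ P.vars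
          · simp [Pi.single_apply, hj]
          · have := hc j
            rw [MvPolynomial.pderiv_eq_zero_of_notMem_vars hj] at this
            simp [Pi.single_apply, hj, ← this])
      rw [sub_eq_iff_eq_add] at hg
      refine ⟨P.vars, c, g, ?_, hσ, ?_⟩
      · by_contra! h
        rw [Finset.sum_eq_zero (fun i hi => by simp [h i hi]), add_zero] at hg
        rw [hg, MvPolynomial.totalDegree_C] at hn
        exact hn0 hn.symm
      · rw [hg] at hP
        simp only [map_add, map_sum, map_mul, twistedTranslation_C, twistedTranslation_X, hσ,
          mul_add, Finset.sum_add_distrib] at hP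
        apply MvPolynomial.C_injective ι K
        simp only [map_sub, map_sum, map_mul]
        linear_combination hP

/-- **Ostrowski's theorem for differences.** If the `yᵢ` satisfy `τ yᵢ = yᵢ + bᵢ` and are
algebraically dependent over `K`, then the `bᵢ` satisfy a nontrivial linear relation, with `σ`-fixed
coefficients, modulo the elements `g - σ g`. A monic relation `P` of least degree in the degree
lexicographic order is fixed by `twistedTranslation σ b`, since the difference between its image and
`P` is a relation of smaller degree. -/
theorem exists_linear_relation_of_not_algebraicIndependent [CharZero K] [LinearOrder ι]
    [WellFoundedGT ι]
    (σ : K →+* K) (τ : L →+* L)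
    (hτ : ∀ a, τ (algebraMap K L a) = algebraMap K L (σ a)) (y : ι → L) (b : ι → K)
    (hy : ∀ i, τ (y i) = y i + algebraMap K L (b i)) (h : ¬ AlgebraicIndependent K y) :
    ∃ (s : Finset ι) (c : ι → K) (g : K), (∃ i ∈ s, c i ≠ 0) ∧ (∀ i, σ (c i) = c i) ∧
      ∑ i ∈ s, c i * b i = g - σ g := by
  classical
  let m : MonomialOrder ι := MonomialOrder.degLex
  have haeval : ∀ P : MvPolynomial ι K,
      MvPolynomial.aeval y (twistedTranslation σ b P) = τ (MvPolynomial.aeval y P) := by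
    intro P
    induction P using MvPolynomial.induction_on with
    | C a => simp [hτ]
    | add p q hp hq => simp only [map_add, hp, hq]
    | mul_X p j hp => simp [map_mul, hp, hy]
  let S : Set (MvPolynomial ι K) := {P | P ≠ 0 ∧ MvPolynomial.aeval y P = 0}
  have hS : S.Nonempty := by
    rw [algebraicIndependent_iff] at h
    push Not at h
    obtain ⟨P, h1, h2⟩ := h
    exact ⟨P, h2, h1⟩
  obtain ⟨P₀, ⟨hP₀, hP₀y⟩, hmin⟩ := (InvImage.wf (fun P => m.toSyn (m.degree P))
    (wellFounded_lt (α := m.syn))).has_min S hS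
  -- With leading coefficient `1` the top term of `P` is not affected by `σ`.
  set P : MvPolynomial ι K := MvPolynomial.C (m.leadingCoeff P₀)⁻¹ * P₀ with hPdef
  have hlc : m.leadingCoeff P₀ ≠ 0 := m.leadingCoeff_ne_zero_iff.2 hP₀
  have hPy : MvPolynomial.aeval y P = 0 := by simp [hPdef, hP₀y]
  have hP1 : P.coeff (m.degree P₀) = 1 := by
    rw [hPdef, MvPolynomial.coeff_C_mul]
    exact inv_mul_cancel₀ hlc
  have hPsupp : P.support ⊆ P₀.support := by
    rw [hPdef, MvPolynomial.C_mul']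
    exact MvPolynomial.support_smul
  have hdeg : P.totalDegree ≤ (m.degree P₀).degree := by
    refine Finset.sup_le fun d hd => ?_
    have h1 := m.le_degree (hPsupp hd)
    rw [MonomialOrder.degLex_le_iff, Finsupp.DegLex.le_iff] at h1
    exact h1.elim le_of_lt fun h => h.1.le
  have hfix : twistedTranslation σ b P = P := by
    by_contra hne
    have hQ : twistedTranslation σ b P - P ∈ S := by
      refine ⟨sub_ne_zero.2 hne, ?_⟩
      rw [map_sub, haeval, hPy, map_zero, sub_zero]
    refine hmin _ hQ ?_
    change m.toSyn _ < m.toSyn _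
    have hmem := m.degree_mem_support hQ.1
    set d := m.degree (twistedTranslation σ b P - P)
    by_cases hd : d ∈ (twistedTranslation σ b P - MvPolynomial.map σ P).support
    · have := (degree_lt_of_mem_support_twistedTranslation_sub_map σ b P hd).trans_le hdeg
      exact MonomialOrder.degLex_lt_iff.2 (Finsupp.DegLex.lt_iff.2 (Or.inl this))
    · rw [MvPolynomial.notMem_support_iff, MvPolynomial.coeff_sub, MvPolynomial.coeff_map,
        sub_eq_zero] at hd
      rw [MvPolynomial.mem_support_iff, MvPolynomial.coeff_sub, hd] at hmem
      have h1 : d ∈ P.support := by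
        rw [MvPolynomial.mem_support_iff]
        intro h0
        simp [h0] at hmem
      refine lt_of_le_of_ne (m.le_degree (hPsupp h1)) fun h2 => ?_
      rw [m.toSyn.injective h2, hP1] at hmem
      simp at hmem
  refine exists_linear_relation_of_twistedTranslation_eq σ b _ P rfl (fun h0 => ?_) hfix
  rw [MvPolynomial.totalDegree_eq_zero_iff_eq_C] at h0
  rw [h0] at hPy
  simp only [MvPolynomial.algHom_C, map_eq_zero] at hPy
  rw [hPy, map_zero] at h0
  rw [h0] at hP1
  simp at hP1

end Ostrowski

/-! ### Poles of rational functions and the shift -/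

lemma injective_algebraMap_comp_shift : Function.Injective
    ((algebraMap (Polynomial ℂ) (RatFunc ℂ)).comp
      (Polynomial.compRingHom (Polynomial.X + Polynomial.C 1))) := by
  refine (RatFunc.algebraMap_injective ℂ).comp ((injective_iff_map_eq_zero _).2 fun p hp => ?_)
  have h := congrArg (fun q : Polynomial ℂ => q.comp (Polynomial.X - Polynomial.C 1)) hp
  simpa [Polynomial.comp_assoc] using h

/-- The shift `r(z) ↦ r(z + 1)` of rational functions. -/
noncomputable def ratFuncShift : RatFunc ℂ →+* RatFunc ℂ :=
  IsFractionRing.lift injective_algebraMap_comp_shift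

lemma ratFuncShift_algebraMap (p : Polynomial ℂ) :
    ratFuncShift (algebraMap _ _ p) =
      algebraMap _ _ (p.comp (Polynomial.X + Polynomial.C 1)) :=
  IsFractionRing.lift_algebraMap injective_algebraMap_comp_shift p

/-- `RegularAt a g` says that the rational function `g` has no pole at `a`. -/
def RatFunc.RegularAt (a : ℂ) (g : RatFunc ℂ) : Prop :=
  ∃ p q : Polynomial ℂ, q.eval a ≠ 0 ∧
    algebraMap (Polynomial ℂ) (RatFunc ℂ) q * g = algebraMap (Polynomial ℂ) (RatFunc ℂ) p

namespace RatFunc.RegularAt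

variable {a : ℂ} {g h : RatFunc ℂ}

lemma of_polynomial (p : Polynomial ℂ) : RegularAt a (algebraMap _ _ p) := ⟨p, 1, by simp, by simp⟩

lemma mul (hg : RegularAt a g) (hh : RegularAt a h) : RegularAt a (g * h) := by
  obtain ⟨p, q, hq, hp⟩ := hg
  obtain ⟨p', q', hq', hp'⟩ := hh
  refine ⟨p * p', q * q', by simp [hq, hq'], ?_⟩
  rw [map_mul, map_mul, ← hp, ← hp']
  ring

lemma add (hg : RegularAt a g) (hh : RegularAt a h) : RegularAt a (g + h) := by
  obtain ⟨p, q, hq, hp⟩ := hg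
  obtain ⟨p', q', hq', hp'⟩ := hh
  refine ⟨p * q' + p' * q, q * q', by simp [hq, hq'], ?_⟩
  simp only [map_mul, map_add, ← hp, ← hp']
  ring

lemma neg (hg : RegularAt a g) : RegularAt a (-g) := by
  obtain ⟨p, q, hq, hp⟩ := hg
  exact ⟨-p, q, hq, by rw [mul_neg, hp, map_neg]⟩

lemma sub (hg : RegularAt a g) (hh : RegularAt a h) : RegularAt a (g - h) :=
  sub_eq_add_neg g h ▸ hg.add hh.neg

lemma sum {ι : Type*} (s : Finset ι) {f : ι → RatFunc ℂ} (hf : ∀ i ∈ s, RegularAt a (f i)) :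
    RegularAt a (∑ i ∈ s, f i) :=
  Finset.sum_induction f (RegularAt a) (fun _ _ => add) (by simpa using of_polynomial 0) hf

lemma X_inv_pow (ha : a ≠ 0) (n : ℕ) : RegularAt a ((RatFunc.X⁻¹) ^ n : RatFunc ℂ) := by
  refine ⟨1, Polynomial.X ^ n, by simp [ha], ?_⟩
  rw [map_pow, RatFunc.algebraMap_X, ← mul_pow, mul_inv_cancel₀ RatFunc.X_ne_zero, one_pow, map_one]

/-- Shifting moves poles by one to the left. -/
lemma shift (hg : RegularAt (a + 1) g) : RegularAt a (ratFuncShift g) := by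
  obtain ⟨p, q, hq, hp⟩ := hg
  refine ⟨p.comp (Polynomial.X + Polynomial.C 1), q.comp (Polynomial.X + Polynomial.C 1),
    by simpa using hq, ?_⟩
  rw [← ratFuncShift_algebraMap, ← ratFuncShift_algebraMap, ← hp, map_mul]

lemma of_shift (hg : RegularAt a (ratFuncShift g)) : RegularAt (a + 1) g := by
  obtain ⟨p, q, hq, hp⟩ := hg
  refine ⟨p.comp (Polynomial.X - Polynomial.C 1), q.comp (Polynomial.X - Polynomial.C 1),
    by simpa using hq, ?_⟩
  apply ratFuncShift.injective
  rw [map_mul, ratFuncShift_algebraMap, ratFuncShift_algebraMap, Polynomial.comp_assoc,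
    Polynomial.comp_assoc]
  simpa using hp

lemma finite_compl (g : RatFunc ℂ) : {a | ¬ RegularAt a g}.Finite := by
  refine (Polynomial.rootSet_finite g.denom ℂ).subset fun a ha => ?_
  rw [Polynomial.mem_rootSet]
  refine ⟨g.denom_ne_zero, ?_⟩
  by_contra h
  refine ha ⟨g.num, g.denom, by simpa using h, ?_⟩
  have h0 : algebraMap (Polynomial ℂ) (RatFunc ℂ) g.denom ≠ 0 :=
    RatFunc.algebraMap_ne_zero g.denom_ne_zero
  have h1 := RatFunc.num_div_denom g
  rw [div_eq_iff h0] at h1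
  rw [h1, mul_comm]

/-- A rational function is regular at `n` and at `-n` for all large natural numbers `n`. -/
lemma exists_nat (g : RatFunc ℂ) : ∃ N : ℕ, ∀ n : ℤ, (N : ℤ) ≤ |n| → RegularAt (n : ℂ) g := by
  have h : ((Int.cast : ℤ → ℂ) ⁻¹' {a | ¬ RegularAt a g}).Finite :=
    (finite_compl g).preimage Int.cast_injective.injOn
  obtain ⟨N, hN⟩ := (h.image Int.natAbs).bddAbove
  refine ⟨N + 1, fun n hn => ?_⟩
  by_contra hc
  have h1 := hN ⟨n, hc, rfl⟩
  rw [Int.abs_eq_natAbs] at hn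
  omega

/-- If `g(z) - g(z+1)` has no pole outside `0`, then `g` is regular at all integers. -/
lemma of_sub_shift (hg : ∀ n : ℤ, n ≠ 0 → RegularAt (n : ℂ) (g - ratFuncShift g)) (n : ℤ) :
    RegularAt (n : ℂ) g := by
  obtain ⟨N, hN⟩ := exists_nat g
  have hpos : ∀ k : ℕ, 0 < (N : ℤ) + 1 - k → RegularAt (((N : ℤ) + 1 - k : ℤ) : ℂ) g := by
    intro k
    induction k with
    | zero => exact fun _ => hN _ (by simp; rw [abs_of_nonneg] <;> omega)
    | succ k ih =>
      intro hk
      have h1 := ih (by push_cast at hk; omega)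
      have h2 : RegularAt (((N : ℤ) + 1 - (k + 1 : ℕ) : ℤ) : ℂ) (ratFuncShift g) := by
        apply shift
        convert h1 using 1
        push_cast; ring
      simpa using (hg _ hk.ne').add h2
  have hneg : ∀ k : ℕ, -(N : ℤ) + k ≤ 0 → RegularAt ((-(N : ℤ) + k : ℤ) : ℂ) g := by
    intro k
    induction k with
    | zero => exact fun _ => hN _ (by simp)
    | succ k ih =>
      intro hk
      have h0 : -(N : ℤ) + k ≠ 0 := by push_cast at hk; omega
      have h1 := ih (by push_cast at hk; omega)
      have h2 := of_shift (by simpa using h1.sub (hg _ h0))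
      convert h2 using 1
      push_cast; ring
  rcases le_or_gt (N : ℤ) |n| with h | h
  · exact hN n h
  rcases lt_or_ge 0 n with h0 | h0
  · rw [abs_of_pos h0] at h
    have := hpos (N + 1 - n).toNat
    have e : (N : ℤ) + 1 - ((N + 1 - n).toNat : ℕ) = n := by omega
    rw [e] at this
    exact this h0
  · rw [abs_of_nonpos h0] at h
    have := hneg (N + n).toNat
    have e : -(N : ℤ) + ((N + n).toNat : ℕ) = n := by omega
    rw [e] at this
    exact this h0

end RatFunc.RegularAt

/-- The principal parts `b i / z ^ (i + 1)` are linearly independent modulo differences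
`g(z) - g(z+1)`, even over the shift invariant rational functions. -/
lemma not_exists_linear_relation_ratFunc (b : ℕ → ℂ) (hb : ∀ i, b i ≠ 0) (s : Finset ℕ)
    (c : ℕ → RatFunc ℂ) (g : RatFunc ℂ) (hc : ∃ i ∈ s, c i ≠ 0)
    (hσ : ∀ i, ratFuncShift (c i) = c i) :
    ∑ i ∈ s, c i * (RatFunc.C (b i) * RatFunc.X⁻¹ ^ (i + 1)) ≠ g - ratFuncShift g := by
  classical
  intro h
  -- Shift invariant functions and their inverses have no poles on the integers.
  have hcreg : ∀ (i : ℕ) (n : ℤ), RatFunc.RegularAt (n : ℂ) (c i) := fun i =>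
    RatFunc.RegularAt.of_sub_shift fun n _ => by
      simpa [hσ] using RatFunc.RegularAt.of_polynomial (a := (n : ℂ)) 0
  have hcreg' : ∀ i, RatFunc.RegularAt 0 (c i)⁻¹ := fun i => by
    simpa using RatFunc.RegularAt.of_sub_shift (g := (c i)⁻¹) (fun n _ => by
      simpa [hσ] using RatFunc.RegularAt.of_polynomial (a := (n : ℂ)) 0) 0
  have hC : ∀ (a x : ℂ), RatFunc.RegularAt a (RatFunc.C x) := fun a x => by
    simpa using RatFunc.RegularAt.of_polynomial (a := a) (Polynomial.C x)
  have hg : ∀ n : ℤ, RatFunc.RegularAt (n : ℂ) g :=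
    RatFunc.RegularAt.of_sub_shift fun n hn => by
      rw [← h]
      exact .sum _ fun i _ => (hcreg i n).mul ((hC _ _).mul (.X_inv_pow (by exact_mod_cast hn) _))
  have h0 : RatFunc.RegularAt 0 (g - ratFuncShift g) := by
    refine .sub (by simpa using hg 0) (.shift ?_)
    simpa using hg 1
  rw [← h] at h0
  -- After multiplication by `z ^ m` only the summand with the largest index `m` keeps a pole
  -- at `0`.
  obtain ⟨m, hm, hmax⟩ := (s.filter fun i => c i ≠ 0).exists_max_image id
    (by obtain ⟨i, hi, hi'⟩ := hc; exact ⟨i, by simp [hi, hi']⟩)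
  rw [Finset.mem_filter] at hm
  have hXr : ∀ n : ℕ, RatFunc.RegularAt 0 (RatFunc.X ^ n : RatFunc ℂ) := fun n => by
    simpa using RatFunc.RegularAt.of_polynomial (a := 0) (Polynomial.X ^ n)
  have h1 : RatFunc.RegularAt 0 (c m * (RatFunc.C (b m) * RatFunc.X⁻¹)) := by
    have e : c m * (RatFunc.C (b m) * RatFunc.X⁻¹) =
        RatFunc.X ^ m * ∑ i ∈ s, c i * (RatFunc.C (b i) * RatFunc.X⁻¹ ^ (i + 1)) -
        ∑ i ∈ s.erase m, RatFunc.X ^ m * (c i * (RatFunc.C (b i) * RatFunc.X⁻¹ ^ (i + 1))) := by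
      rw [← Finset.mul_sum, ← mul_sub, ← Finset.add_sum_erase s _ hm.1, add_sub_cancel_right]
      have := RatFunc.X_ne_zero (K := ℂ)
      simp only [inv_pow]
      field_simp
      ring
    rw [e]
    refine .sub ((hXr m).mul h0) (.sum _ fun i hi => ?_)
    rw [Finset.mem_erase] at hi
    by_cases hci : c i = 0
    · simpa [hci] using RatFunc.RegularAt.of_polynomial (a := 0) 0
    · have him : i < m := lt_of_le_of_ne (hmax i (by simp [hi.2, hci])) hi.1
      obtain ⟨k, rfl⟩ := Nat.exists_eq_add_of_lt him
      have e2 : RatFunc.X ^ (i + k + 1) * (c i * (RatFunc.C (b i) * RatFunc.X⁻¹ ^ (i + 1))) =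
          RatFunc.X ^ k * (c i * RatFunc.C (b i)) := by
        have := RatFunc.X_ne_zero (K := ℂ)
        simp only [inv_pow]
        field_simp
        ring
      rw [e2]
      exact (hXr k).mul ((by simpa using hcreg i 0 : RatFunc.RegularAt 0 (c i)).mul (hC _ _))
  have h2 : RatFunc.RegularAt 0 (RatFunc.X⁻¹ : RatFunc ℂ) := by
    have := ((hC 0 (b m)⁻¹).mul (hcreg' m)).mul h1
    convert this using 1
    have hb' : (RatFunc.C (b m) : RatFunc ℂ) ≠ 0 := by simpa using hb m
    have := hm.2
    rw [map_inv₀]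
    field_simp
  obtain ⟨p, q, hq, hp⟩ := h2
  have hX := RatFunc.X_ne_zero (K := ℂ)
  rw [mul_inv_eq_iff_eq_mul₀ hX, ← RatFunc.algebraMap_X, ← map_mul] at hp
  have := RatFunc.algebraMap_injective ℂ hp
  rw [this] at hq
  simp at hq

/-! ### The filter of codiscrete sets and the identity theorem -/

section Codiscrete

/-- The identity theorem: a meromorphic function on `ℂ` vanishes outside a discrete set, or it has
no zeros outside a discrete set. -/
lemma Meromorphic.eventually_eq_zero_or_eventually_ne_zero {f : ℂ → ℂ} (hf : Meromorphic f) :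
    (∀ᶠ z in codiscrete ℂ, f z = 0) ∨ ∀ᶠ z in codiscrete ℂ, f z ≠ 0 := by
  have hf' : MeromorphicOn f Set.univ := hf.meromorphicOn
  by_cases h : ∃ x, meromorphicOrderAt f x ≠ ⊤
  · right
    obtain ⟨x, hx⟩ := h
    refine hf'.eventually_codiscreteWithin_apply_ne_zero fun y _ => ?_
    exact hf'.meromorphicOrderAt_ne_top_of_isPreconnected isPreconnected_univ
      (Set.mem_univ x) (Set.mem_univ y) hx
  · left
    push Not at h
    rw [eventually_iff, mem_codiscrete]
    intro x
    rw [disjoint_principal_right, compl_compl]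
    exact meromorphicOrderAt_eq_top_iff.1 (h x)

lemma eventually_codiscrete_iff {p : ℂ → Prop} :
    (∀ᶠ z in codiscrete ℂ, p z) ↔ ∀ x, ∀ᶠ z in nhdsWithin x {x}ᶜ, p z := by
  rw [eventually_iff, mem_codiscrete]
  simp only [disjoint_principal_right, compl_compl]
  rfl

instance : (codiscrete ℂ).NeBot := by
  refine ⟨fun h => ?_⟩
  have h1 : ∀ᶠ z in codiscrete ℂ, False := by rw [h]; exact eventually_bot
  exact (eventually_codiscrete_iff.1 h1 0).exists.elim fun _ => id

/-- A meromorphic function that vanishes on a nonempty open set vanishes outside a discrete set. -/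
lemma Meromorphic.eventually_eq_zero_of_eqOn {f : ℂ → ℂ} (hf : Meromorphic f) {U : Set ℂ}
    (hU : IsOpen U) (hne : U.Nonempty) (h : ∀ z ∈ U, f z = 0) : ∀ᶠ z in codiscrete ℂ, f z = 0 := by
  refine hf.eventually_eq_zero_or_eventually_ne_zero.resolve_right fun h1 => ?_
  obtain ⟨x, hx⟩ := hne
  have h2 := eventually_codiscrete_iff.1 h1 x
  have h3 : ∀ᶠ z in nhdsWithin x {x}ᶜ, z ∈ U := mem_nhdsWithin_of_mem_nhds (hU.mem_nhds hx)
  obtain ⟨z, hz, hz'⟩ := (h2.and h3).exists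
  exact hz (h z hz')

lemma Filter.Eventually.codiscrete_comp_add {p : ℂ → Prop} (h : ∀ᶠ z in codiscrete ℂ, p z)
    (c : ℂ) : ∀ᶠ z in codiscrete ℂ, p (z + c) := by
  rw [eventually_codiscrete_iff] at h ⊢
  intro x
  have ht : Tendsto (fun z => z + c) (nhdsWithin x {x}ᶜ) (nhdsWithin (x + c) {x + c}ᶜ) := by
    refine ContinuousWithinAt.tendsto_nhdsWithin (by fun_prop) fun z hz => ?_
    simpa using hz
  exact ht.eventually (h (x + c))

lemma Filter.Eventually.codiscrete_eventually_nhds {p : ℂ → Prop}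
    (h : ∀ᶠ z in codiscrete ℂ, p z) : ∀ᶠ z in codiscrete ℂ, ∀ᶠ w in nhds z, p w := by
  rw [eventually_codiscrete_iff] at h ⊢
  intro x
  have h1 := eventually_eventually_nhdsWithin.2 (h x)
  filter_upwards [h1, self_mem_nhdsWithin] with z hz hzx
  rwa [isOpen_compl_singleton.nhdsWithin_eq hzx] at hz

lemma Filter.EventuallyEq.codiscrete_deriv {f g : ℂ → ℂ} (h : f =ᶠ[codiscrete ℂ] g) :
    deriv f =ᶠ[codiscrete ℂ] deriv g :=
  h.codiscrete_eventually_nhds.mono fun _ hz => EventuallyEq.deriv_eq hz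

lemma Meromorphic.eventually_differentiableAt {f : ℂ → ℂ} (hf : Meromorphic f) :
    ∀ᶠ z in codiscrete ℂ, DifferentiableAt ℂ f z :=
  eventually_codiscrete_iff.2 fun x =>
    (hf x).eventually_analyticAt.mono fun _ h => h.differentiableAt

end Codiscrete

/-! ### The field of meromorphic functions -/

section Germs

/-- Germs of meromorphic functions on `ℂ`, modulo equality outside a discrete set. -/
noncomputable def meromorphicGermSubring : Subring (Germ (codiscrete ℂ) ℂ) where
  carrier := {g | ∃ f : ℂ → ℂ, Meromorphic f ∧ (f : Germ (codiscrete ℂ) ℂ) = g}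
  mul_mem' := by
    rintro _ _ ⟨f, hf, rfl⟩ ⟨g, hg, rfl⟩
    exact ⟨f * g, hf.mul hg, rfl⟩
  one_mem' := ⟨1, Meromorphic.const 1, rfl⟩
  add_mem' := by
    rintro _ _ ⟨f, hf, rfl⟩ ⟨g, hg, rfl⟩
    exact ⟨f + g, hf.add hg, rfl⟩
  zero_mem' := ⟨0, Meromorphic.const 0, rfl⟩
  neg_mem' := by
    rintro _ ⟨f, hf, rfl⟩
    exact ⟨-f, hf.neg, rfl⟩

/-- The field of meromorphic functions on `ℂ`, two functions being identified if they agree outside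
a discrete set. -/
def MeromorphicGerm : Type := meromorphicGermSubring

namespace MeromorphicGerm

noncomputable instance : CommRing MeromorphicGerm :=
  inferInstanceAs (CommRing meromorphicGermSubring)

/-- The element of the field represented by a meromorphic function. -/
noncomputable def mk (f : ℂ → ℂ) (hf : Meromorphic f) : MeromorphicGerm :=
  ⟨(f : Germ (codiscrete ℂ) ℂ), f, hf, rfl⟩

lemma mk_eq_mk {f g : ℂ → ℂ} {hf : Meromorphic f} {hg : Meromorphic g} :
    mk f hf = mk g hg ↔ f =ᶠ[codiscrete ℂ] g := by
  rw [← Germ.coe_eq]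
  exact Subtype.ext_iff

lemma exists_mk (x : MeromorphicGerm) : ∃ f hf, x = mk f hf := by
  obtain ⟨_, f, hf, rfl⟩ := x
  exact ⟨f, hf, rfl⟩

lemma mk_add {f g : ℂ → ℂ} (hf : Meromorphic f) (hg : Meromorphic g) :
    mk f hf + mk g hg = mk (f + g) (hf.add hg) := rfl

lemma mk_mul {f g : ℂ → ℂ} (hf : Meromorphic f) (hg : Meromorphic g) :
    mk f hf * mk g hg = mk (f * g) (hf.mul hg) := rfl

lemma zero_def : (0 : MeromorphicGerm) = mk (fun _ => 0) (.const 0) := rfl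

lemma one_def : (1 : MeromorphicGerm) = mk (fun _ => 1) (.const 1) := rfl

lemma mk_eq_zero {f : ℂ → ℂ} {hf : Meromorphic f} :
    mk f hf = 0 ↔ ∀ᶠ z in codiscrete ℂ, f z = 0 := by
  rw [zero_def, mk_eq_mk]
  rfl

lemma isField : IsField MeromorphicGerm where
  exists_pair_ne := by
    refine ⟨0, 1, fun h => ?_⟩
    rw [zero_def, one_def, mk_eq_mk] at h
    obtain ⟨z, hz⟩ := h.exists
    exact zero_ne_one hz
  mul_comm := mul_comm
  mul_inv_cancel := by
    intro a ha
    obtain ⟨f, hf, rfl⟩ := exists_mk a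
    refine ⟨mk f⁻¹ hf.inv, ?_⟩
    rw [mk_mul, one_def, mk_eq_mk]
    rcases hf.eventually_eq_zero_or_eventually_ne_zero with h | h
    · exact absurd (mk_eq_zero.2 h) ha
    · exact h.mono fun z hz => mul_inv_cancel₀ hz

noncomputable instance : Field MeromorphicGerm := isField.toField

lemma mk_div {f g : ℂ → ℂ} (hf : Meromorphic f) (hg : Meromorphic g) :
    mk f hf / mk g hg = mk (f / g) (hf.div hg) := by
  rcases hg.eventually_eq_zero_or_eventually_ne_zero with h | h
  · have h1 : mk g hg = 0 := mk_eq_zero.2 h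
    rw [h1, div_zero]
    exact (mk_eq_zero.2 (h.mono fun z hz => by simp [hz])).symm
  · have h1 : mk g hg ≠ 0 := fun h0 => by
      rw [mk_eq_zero] at h0
      obtain ⟨z, hz, hz'⟩ := (h.and h0).exists
      exact hz hz'
    rw [div_eq_iff h1]
    rw [mk_mul, mk_eq_mk]
    exact h.mono fun z hz => by simp [hz]

/-- The inclusion of the field of meromorphic germs into the ring of all germs. -/
noncomputable def val : MeromorphicGerm →+* Germ (codiscrete ℂ) ℂ := meromorphicGermSubring.subtype

lemma val_injective : Function.Injective val := Subtype.val_injective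

lemma val_mk {f : ℂ → ℂ} (hf : Meromorphic f) : val (mk f hf) = Germ.coeRingHom _ f := rfl

lemma _root_.Meromorphic.polynomial_eval (p : Polynomial ℂ) : Meromorphic fun z => p.eval z :=
  fun z => (p.differentiable.analyticAt z).meromorphicAt

/-- Polynomials as meromorphic germs. -/
noncomputable def ofPolynomial : Polynomial ℂ →+* MeromorphicGerm where
  toFun p := mk (fun z => p.eval z) (.polynomial_eval p)
  map_one' := by
    rw [one_def, mk_eq_mk]
    exact .of_forall fun z => by simp
  map_mul' a b := by
    rw [mk_mul, mk_eq_mk]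
    exact .of_forall fun z => by simp
  map_zero' := by
    rw [zero_def, mk_eq_mk]
    exact .of_forall fun z => by simp
  map_add' a b := by
    rw [mk_add, mk_eq_mk]
    exact .of_forall fun z => by simp

lemma ofPolynomial_apply (p : Polynomial ℂ) :
    ofPolynomial p = mk (fun z => p.eval z) (.polynomial_eval p) := rfl

lemma ofPolynomial_injective : Function.Injective ofPolynomial := by
  refine (injective_iff_map_eq_zero _).2 fun p hp => ?_
  rw [ofPolynomial_apply, mk_eq_zero] at hp
  by_contra h
  have h1 : ∀ᶠ z in codiscrete ℂ, p.eval z ≠ 0 := by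
    filter_upwards [(p.rootSet_finite ℂ).compl_mem_codiscrete] with z hz
    simpa [Polynomial.mem_rootSet, h] using hz
  obtain ⟨z, hz, hz'⟩ := (hp.and h1).exists
  exact hz' hz

noncomputable instance : Algebra (RatFunc ℂ) MeromorphicGerm :=
  (IsFractionRing.lift ofPolynomial_injective : RatFunc ℂ →+* MeromorphicGerm).toAlgebra

lemma algebraMap_polynomial (p : Polynomial ℂ) :
    algebraMap (RatFunc ℂ) MeromorphicGerm (algebraMap _ _ p) = ofPolynomial p :=
  IsFractionRing.lift_algebraMap ofPolynomial_injective p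

lemma algebraMap_ratFunc (r : RatFunc ℂ) :
    algebraMap (RatFunc ℂ) MeromorphicGerm r = ofPolynomial r.num / ofPolynomial r.denom := by
  conv_lhs => rw [← RatFunc.num_div_denom r]
  rw [map_div₀, algebraMap_polynomial, algebraMap_polynomial]

lemma algebraMap_C (c : ℂ) : algebraMap (RatFunc ℂ) MeromorphicGerm (RatFunc.C c) =
    mk (fun _ => c) (.const c) := by
  rw [← RatFunc.algebraMap_C, algebraMap_polynomial, ofPolynomial_apply, mk_eq_mk]
  exact .of_forall fun z => by simp

lemma _root_.meromorphic_id : Meromorphic fun z : ℂ => z := fun z => .id z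

lemma algebraMap_X : algebraMap (RatFunc ℂ) MeromorphicGerm RatFunc.X =
    mk (fun z => z) meromorphic_id := by
  rw [← RatFunc.algebraMap_X, algebraMap_polynomial, ofPolynomial_apply, mk_eq_mk]
  exact .of_forall fun z => by simp

lemma val_algebraMap (r : RatFunc ℂ) : val (algebraMap (RatFunc ℂ) MeromorphicGerm r) =
    Germ.coeRingHom _ fun z => r.eval (RingHom.id ℂ) z := by
  rw [algebraMap_ratFunc, ofPolynomial_apply, ofPolynomial_apply, mk_div, val_mk]
  rfl

instance : CharZero MeromorphicGerm :=
  charZero_of_injective_algebraMap (algebraMap (RatFunc ℂ) MeromorphicGerm).injective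

/-- A function representing a meromorphic germ. -/
noncomputable def rep (x : MeromorphicGerm) : ℂ → ℂ := (exists_mk x).choose

lemma meromorphic_rep (x : MeromorphicGerm) : Meromorphic x.rep := (exists_mk x).choose_spec.choose

lemma mk_rep (x : MeromorphicGerm) : mk x.rep x.meromorphic_rep = x :=
  (exists_mk x).choose_spec.choose_spec.symm

lemma rep_mk {f : ℂ → ℂ} (hf : Meromorphic f) : (mk f hf).rep =ᶠ[codiscrete ℂ] f :=
  mk_eq_mk.1 (mk_rep (mk f hf))

/-- The derivative of a meromorphic germ. -/
noncomputable def derivFun (x : MeromorphicGerm) : MeromorphicGerm :=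
  mk (deriv x.rep) x.meromorphic_rep.deriv

lemma derivFun_mk {f : ℂ → ℂ} (hf : Meromorphic f) : derivFun (mk f hf) = mk (deriv f) hf.deriv :=
  mk_eq_mk.2 (rep_mk hf).codiscrete_deriv

/-- Differentiation of meromorphic germs. -/
noncomputable def D : Derivation ℤ MeromorphicGerm MeromorphicGerm :=
  Derivation.mk' (AddMonoidHom.toIntLinearMap (AddMonoidHom.mk' derivFun fun a b => by
      obtain ⟨f, hf, rfl⟩ := exists_mk a
      obtain ⟨g, hg, rfl⟩ := exists_mk b
      rw [mk_add, derivFun_mk, derivFun_mk, derivFun_mk, mk_add, mk_eq_mk]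
      filter_upwards [hf.eventually_differentiableAt, hg.eventually_differentiableAt] with z h1 h2
      exact deriv_add h1 h2)) fun a b => by
    obtain ⟨f, hf, rfl⟩ := exists_mk a
    obtain ⟨g, hg, rfl⟩ := exists_mk b
    change derivFun _ = _ * derivFun _ + _ * derivFun _
    rw [mk_mul, derivFun_mk, derivFun_mk, derivFun_mk, mk_mul, mk_mul, mk_add, mk_eq_mk]
    filter_upwards [hf.eventually_differentiableAt, hg.eventually_differentiableAt] with z h1 h2
    change deriv (f * g) z = f z * deriv g z + g z * deriv f z
    rw [deriv_mul h1 h2]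
    ring

lemma D_mk {f : ℂ → ℂ} (hf : Meromorphic f) : D (mk f hf) = mk (deriv f) hf.deriv :=
  derivFun_mk hf

lemma _root_.Meromorphic.iteratedDeriv {f : ℂ → ℂ} (hf : Meromorphic f) (n : ℕ) :
    Meromorphic (iteratedDeriv n f) := by
  rw [iteratedDeriv_eq_iterate]
  exact hf.iterated_deriv

lemma D_iterate_mk {f : ℂ → ℂ} (hf : Meromorphic f) (n : ℕ) :
    D^[n] (mk f hf) = mk (iteratedDeriv n f) (hf.iteratedDeriv n) := by
  induction n with
  | zero => exact mk_eq_mk.2 (by rw [iteratedDeriv_zero])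
  | succ n ih =>
    rw [Function.iterate_succ_apply', ih, D_mk]
    exact mk_eq_mk.2 (by rw [iteratedDeriv_succ])

lemma D_algebraMap_mem_range (r : RatFunc ℂ) :
    D (algebraMap (RatFunc ℂ) MeromorphicGerm r) ∈
      (algebraMap (RatFunc ℂ) MeromorphicGerm).range := by
  have hD : ∀ p : Polynomial ℂ, D (ofPolynomial p) = ofPolynomial (Polynomial.derivative p) := by
    intro p
    rw [ofPolynomial_apply, D_mk, ofPolynomial_apply, mk_eq_mk]
    exact Eventually.of_forall fun z => p.deriv
  have hmem : ∀ p : Polynomial ℂ,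
      ofPolynomial p ∈ (algebraMap (RatFunc ℂ) MeromorphicGerm).fieldRange :=
    fun p => ⟨_, algebraMap_polynomial p⟩
  rw [algebraMap_ratFunc, Derivation.leibniz_div, hD, hD]
  change _ ∈ (algebraMap (RatFunc ℂ) MeromorphicGerm).fieldRange
  exact mul_mem (pow_mem (inv_mem (hmem _)) 2)
    (sub_mem (mul_mem (hmem _) (hmem _)) (mul_mem (hmem _) (hmem _)))

lemma _root_.Meromorphic.comp_add {f : ℂ → ℂ} (hf : Meromorphic f) (c : ℂ) :
    Meromorphic fun z => f (z + c) :=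
  Meromorphic.meromorphic_fun_comp_add_const_iff_meromorphic.2 hf

/-- The action of `f(z) ↦ f(z + c)` on meromorphic germs. -/
noncomputable def shiftFun (c : ℂ) (x : MeromorphicGerm) : MeromorphicGerm :=
  mk (fun z => x.rep (z + c)) (x.meromorphic_rep.comp_add c)

lemma shiftFun_mk (c : ℂ) {f : ℂ → ℂ} (hf : Meromorphic f) :
    shiftFun c (mk f hf) = mk (fun z => f (z + c)) (hf.comp_add c) :=
  mk_eq_mk.2 ((rep_mk hf).codiscrete_comp_add c)

/-- The endomorphism `f(z) ↦ f(z + c)` of the field of meromorphic germs. -/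
noncomputable def shift (c : ℂ) : MeromorphicGerm →+* MeromorphicGerm where
  toFun := shiftFun c
  map_one' := shiftFun_mk c (.const 1)
  map_zero' := shiftFun_mk c (.const 0)
  map_mul' a b := by
    obtain ⟨f, hf, rfl⟩ := exists_mk a
    obtain ⟨g, hg, rfl⟩ := exists_mk b
    rw [mk_mul, shiftFun_mk, shiftFun_mk, shiftFun_mk]
    rfl
  map_add' a b := by
    obtain ⟨f, hf, rfl⟩ := exists_mk a
    obtain ⟨g, hg, rfl⟩ := exists_mk b
    rw [mk_add, shiftFun_mk, shiftFun_mk, shiftFun_mk]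
    rfl

lemma shift_mk (c : ℂ) {f : ℂ → ℂ} (hf : Meromorphic f) :
    shift c (mk f hf) = mk (fun z => f (z + c)) (hf.comp_add c) := shiftFun_mk c hf

lemma D_shift (c : ℂ) (x : MeromorphicGerm) : D (shift c x) = shift c (D x) := by
  obtain ⟨f, hf, rfl⟩ := exists_mk x
  rw [shift_mk, D_mk, D_mk, shift_mk, mk_eq_mk]
  exact Eventually.of_forall fun z => deriv_comp_add_const f c z

lemma D_iterate_shift (c : ℂ) (x : MeromorphicGerm) (n : ℕ) :
    D^[n] (shift c x) = shift c (D^[n] x) := by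
  induction n with
  | zero => rfl
  | succ n ih => rw [Function.iterate_succ_apply', Function.iterate_succ_apply', ih, D_shift]

lemma shift_algebraMap (r : RatFunc ℂ) : shift 1 (algebraMap (RatFunc ℂ) MeromorphicGerm r) =
    algebraMap (RatFunc ℂ) MeromorphicGerm (ratFuncShift r) := by
  have hp : ∀ p : Polynomial ℂ, shift 1 (ofPolynomial p) =
      ofPolynomial (p.comp (Polynomial.X + Polynomial.C 1)) := by
    intro p
    rw [ofPolynomial_apply, ofPolynomial_apply, shift_mk]
    exact mk_eq_mk.2 (.of_forall fun z => by simp)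
  rw [algebraMap_ratFunc, map_div₀, hp, hp]
  conv_rhs => rw [← RatFunc.num_div_denom r]
  rw [map_div₀, map_div₀, ratFuncShift_algebraMap, ratFuncShift_algebraMap,
    algebraMap_polynomial, algebraMap_polynomial]

/-- The expression `diffPolyEval P f` represents the value of the differential polynomial `P` at the
germ of `f`; values of the coefficients at their poles are irrelevant. -/
lemma val_aeval {f : ℂ → ℂ} (hf : Meromorphic f) (P : MvPolynomial ℕ (RatFunc ℂ)) :
    val (MvPolynomial.aeval (fun i => D^[i] (mk f hf)) P) =
      Germ.coeRingHom _ (diffPolyEval P f) := by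
  have h : diffPolyEval P f = ∑ m ∈ P.support, (fun z => (P.coeff m).eval (RingHom.id ℂ) z) *
      ∏ i ∈ m.support, iteratedDeriv i f ^ m i := by
    funext z
    simp [diffPolyEval, Finsupp.prod]
  rw [h, MvPolynomial.aeval_def, MvPolynomial.eval₂_eq, map_sum, map_sum]
  refine Finset.sum_congr rfl fun m _ => ?_
  rw [map_mul, map_mul, val_algebraMap, map_prod, map_prod]
  congr 1
  refine Finset.prod_congr rfl fun i _ => ?_
  rw [map_pow, map_pow, D_iterate_mk, val_mk]

/-- Differential algebraicity of a meromorphic function is algebraic dependence of the derivatives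
of its germ. -/
lemma not_algebraicIndependent_of_isDiffAlgebraic {f : ℂ → ℂ} (hf : Meromorphic f)
    (h : IsDiffAlgebraic f) :
    ¬ AlgebraicIndependent (RatFunc ℂ) fun i => D^[i] (mk f hf) := by
  obtain ⟨P, hP, hPf⟩ := h
  refine fun hind => hP (hind.eq_zero_of_aeval_eq_zero P (val_injective ?_))
  rw [val_aeval, map_zero]
  exact Germ.coe_eq.2 hPf

end MeromorphicGerm

end Germs

/-! ### Hölder's theorem -/

section Holder

open MeromorphicGerm

lemma MeromorphicGerm.D_X : D (algebraMap (RatFunc ℂ) MeromorphicGerm RatFunc.X) = 1 := by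
  rw [algebraMap_X, D_mk, one_def, mk_eq_mk]
  exact .of_forall fun z => deriv_id z

lemma MeromorphicGerm.D_iterate_X_inv (i : ℕ) :
    D^[i] (algebraMap (RatFunc ℂ) MeromorphicGerm RatFunc.X⁻¹) =
      algebraMap (RatFunc ℂ) MeromorphicGerm
        (RatFunc.C ((-1) ^ i * (i.factorial : ℂ)) * RatFunc.X⁻¹ ^ (i + 1)) := by
  have hC : ∀ c : ℂ, D (algebraMap (RatFunc ℂ) MeromorphicGerm (RatFunc.C c)) = 0 := by
    intro c
    rw [algebraMap_C, D_mk, zero_def, mk_eq_mk]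
    exact .of_forall fun z => deriv_const z c
  induction i with
  | zero => simp
  | succ i ih =>
    rw [Function.iterate_succ_apply', ih, map_mul, Derivation.leibniz, hC, map_pow, map_inv₀,
      Derivation.leibniz_pow, Derivation.leibniz_inv, D_X]
    simp only [smul_eq_mul, nsmul_eq_mul, mul_zero, add_zero, map_mul, map_pow, map_inv₀, map_neg,
      map_one, Nat.factorial_succ, Nat.cast_mul, map_natCast]
    push_cast
    ring

lemma Complex.Gamma_add_one_eventually :
    ∀ᶠ z in codiscrete ℂ, Complex.Gamma (z + 1) = z * Complex.Gamma z := by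
  filter_upwards [(Set.finite_singleton (0 : ℂ)).compl_mem_codiscrete] with z hz
  exact Complex.Gamma_add_one z hz

/-- The Gamma function as an element of the field of meromorphic germs. -/
noncomputable def MeromorphicGerm.gamma : MeromorphicGerm := mk Complex.Gamma Meromorphic.Gamma

lemma MeromorphicGerm.gamma_ne_zero : gamma ≠ 0 := by
  intro h
  rw [gamma, mk_eq_zero] at h
  have h1 := eventually_codiscrete_iff.1 h 1
  have h2 : ∀ᶠ z in nhdsWithin (1 : ℂ) {1}ᶜ, 0 < z.re := by
    refine mem_nhdsWithin_of_mem_nhds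
      ((isOpen_lt continuous_const Complex.continuous_re).mem_nhds ?_)
    simp
  obtain ⟨z, hz, hz'⟩ := (h1.and h2).exists
  exact Complex.Gamma_ne_zero_of_re_pos hz' hz

lemma MeromorphicGerm.shift_gamma :
    shift 1 gamma = algebraMap (RatFunc ℂ) MeromorphicGerm RatFunc.X * gamma := by
  rw [gamma, shift_mk, algebraMap_X, mk_mul, mk_eq_mk]
  exact Complex.Gamma_add_one_eventually

/-- The digamma function `Γ'/Γ` satisfies `ψ(z + 1) = ψ(z) + 1/z`. -/
lemma MeromorphicGerm.shift_digamma : shift 1 (D gamma / gamma) =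
    D gamma / gamma + algebraMap (RatFunc ℂ) MeromorphicGerm RatFunc.X⁻¹ := by
  have hX0 : algebraMap (RatFunc ℂ) MeromorphicGerm RatFunc.X ≠ 0 := by
    simpa using RatFunc.X_ne_zero
  have := gamma_ne_zero
  rw [map_div₀, ← D_shift, shift_gamma, Derivation.leibniz, D_X, map_inv₀, smul_eq_mul, smul_eq_mul]
  field_simp

/-- The derivatives of the digamma function are algebraically independent over `ℂ(z)`. -/
lemma MeromorphicGerm.algebraicIndependent_digamma :
    AlgebraicIndependent (RatFunc ℂ) fun i => D^[i] (D gamma / gamma) := by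
  by_contra h
  -- The degree lexicographic order needs an index set without infinite ascending chains.
  have h' : ¬ AlgebraicIndependent (RatFunc ℂ)
      fun i : ℕᵒᵈ => D^[OrderDual.ofDual i] (D gamma / gamma) := fun h1 =>
    h (h1.comp OrderDual.toDual OrderDual.toDual.injective)
  obtain ⟨s, c, g, hc, hσ, hg⟩ := exists_linear_relation_of_not_algebraicIndependent
    ratFuncShift (shift 1) shift_algebraMap _
    (fun i : ℕᵒᵈ => RatFunc.C ((-1) ^ OrderDual.ofDual i * ((OrderDual.ofDual i).factorial : ℂ)) *
      RatFunc.X⁻¹ ^ (OrderDual.ofDual i + 1)) (fun i => by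
      rw [← D_iterate_X_inv, ← D_iterate_shift, shift_digamma, iterate_map_add]) h'
  exact not_exists_linear_relation_ratFunc (fun i => (-1) ^ i * i.factorial)
    (fun i => mul_ne_zero (pow_ne_zero _ (by norm_num)) (by exact_mod_cast i.factorial_ne_zero))
    s c g hc hσ hg

/-- **Hölder's theorem**, in a form that does not mention a differential equation: no
differential field of finite transcendence degree over `ℂ(z)` contains `Γ`. -/
lemma MeromorphicGerm.gamma_notMem {S : Set MeromorphicGerm} (hS : S.Finite)
    (hD : ∀ s ∈ S, D s ∈ algebraicClosure (IntermediateField.adjoin (RatFunc ℂ) S)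
      MeromorphicGerm) :
    gamma ∉ algebraicClosure (IntermediateField.adjoin (RatFunc ℂ) S) MeromorphicGerm := by
  intro h
  have hstable := fun x hx =>
    D.algebraicClosure_adjoin_stable D_algebraMap_mem_range S hD (x := x) hx
  refine not_algebraicIndependent_of_mem_algebraicClosure hS _ (fun i => ?_)
    algebraicIndependent_digamma
  induction i with
  | zero => exact div_mem (hstable _ h) h
  | succ i ih =>
    rw [Function.iterate_succ_apply']
    exact hstable _ ih

lemma MeromorphicGerm.not_algebraicIndependent_shift {x : MeromorphicGerm}
    (hx : ¬ AlgebraicIndependent (RatFunc ℂ) fun i => D^[i] x) :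
    ¬ AlgebraicIndependent (RatFunc ℂ) fun i => D^[i] (shift 1 x) := by
  rw [algebraicIndependent_iff] at hx ⊢
  push Not at hx ⊢
  obtain ⟨P, hP, hP0⟩ := hx
  have key : ∀ Q : MvPolynomial ℕ (RatFunc ℂ),
      MvPolynomial.aeval (fun i => D^[i] (shift 1 x)) (MvPolynomial.map ratFuncShift Q) =
        shift 1 (MvPolynomial.aeval (fun i => D^[i] x) Q) := by
    intro Q
    induction Q using MvPolynomial.induction_on with
    | C a => simp [shift_algebraMap]
    | add p q hp hq => simp only [map_add, hp, hq]
    | mul_X p i hp =>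
      rw [map_mul, map_mul, map_mul, map_mul, hp, MvPolynomial.map_X, MvPolynomial.aeval_X,
        MvPolynomial.aeval_X, D_iterate_shift]
  refine ⟨MvPolynomial.map ratFuncShift P, ?_, fun h => hP0 ?_⟩
  · rw [key, hP, map_zero]
  · exact MvPolynomial.map_injective _ ratFuncShift.injective (h.trans (map_zero _).symm)

/-- A meromorphic solution of a first order difference equation with constant coefficients, the
right-hand side being a polynomial multiple of `Γ`, is differentially transcendental: otherwise it
would generate together with its shift a differential field of finite transcendence degree, and
this field would contain `Γ`. -/
theorem isDiffTranscendental_of_difference_eq {F : ℂ → ℂ} (hF : Meromorphic F) (ε : ℂ)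
    {q : Polynomial ℂ} (hq : q ≠ 0)
    (h : ∀ᶠ z in codiscrete ℂ, F (z + 1) + ε * F z = q.eval z * Complex.Gamma z) :
    IsDiffTranscendental F := by
  intro halg
  have h0 := not_algebraicIndependent_of_isDiffAlgebraic hF halg
  obtain ⟨S, hS, hFS, hDS⟩ := exists_finite_differentialClosure D h0
  obtain ⟨T, hT, hFT, hDT⟩ :=
    exists_finite_differentialClosure D (not_algebraicIndependent_shift h0)
  have hmono : ∀ {A B : Set MeromorphicGerm}, A ⊆ B → ∀ {x},
      x ∈ algebraicClosure (IntermediateField.adjoin (RatFunc ℂ) A) MeromorphicGerm →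
      x ∈ algebraicClosure (IntermediateField.adjoin (RatFunc ℂ) B) MeromorphicGerm := by
    intro A B hAB x hx
    rw [mem_algebraicClosure_adjoin_iff] at hx ⊢
    exact hx.adjoin_of_forall_isAlgebraic fun y hy => absurd (hAB hy.1) hy.2
  refine gamma_notMem (hS.union hT) (fun s hs => ?_) ?_
  · rcases hs with hs | hs
    · exact hmono Set.subset_union_left (hDS s hs)
    · exact hmono Set.subset_union_right (hDT s hs)
  · have hK : ∀ a, algebraMap (RatFunc ℂ) MeromorphicGerm a ∈ algebraicClosure
        (IntermediateField.adjoin (RatFunc ℂ) (S ∪ T)) MeromorphicGerm := fun a =>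
      (algebraicClosure (IntermediateField.adjoin (RatFunc ℂ) (S ∪ T))
        MeromorphicGerm).algebraMap_mem
        ⟨_, IntermediateField.algebraMap_mem _ a⟩
    have hq0 : ofPolynomial q ≠ 0 := fun h1 =>
      hq (ofPolynomial_injective (h1.trans (map_zero _).symm))
    have e : gamma = (ofPolynomial q)⁻¹ * (shift 1 (mk F hF) +
        algebraMap (RatFunc ℂ) MeromorphicGerm (RatFunc.C ε) * mk F hF) := by
      rw [eq_inv_mul_iff_mul_eq₀ hq0, gamma, ofPolynomial_apply, shift_mk, algebraMap_C, mk_mul,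
        mk_mul, mk_add, mk_eq_mk]
      exact h.mono fun z hz => hz.symm
    rw [e, ← algebraMap_polynomial]
    exact mul_mem (inv_mem (hK _)) (add_mem (hmono Set.subset_union_right hFT)
      (mul_mem (hK _) (hmono Set.subset_union_left hFS)))

end Holder

/-! ### The series of shifted Gamma functions -/

section Series

/-- Along `n + 1 - z` the reciprocal Gamma function decays geometrically, locally uniformly
in `z`. -/
lemma exists_bound_inv_Gamma (R : ℝ) : ∃ C : ℝ, ∀ n : ℕ, ∀ z ∈ Metric.closedBall (0 : ℂ) R,
    ‖(Complex.Gamma (n + 1 - z))⁻¹‖ ≤ C * (1 / 2) ^ n := by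
  have hcont : ∀ n : ℕ, ∃ C : ℝ, ∀ z ∈ Metric.closedBall (0 : ℂ) R,
      ‖(Complex.Gamma (n + 1 - z))⁻¹‖ ≤ C := fun n =>
    (isCompact_closedBall (0 : ℂ) R).exists_bound_of_continuousOn
      (Complex.differentiable_one_div_Gamma.continuous.comp
        (by fun_prop : Continuous fun z : ℂ => (n : ℂ) + 1 - z)).continuousOn
  choose c hc using hcont
  obtain ⟨N, hN⟩ := exists_nat_ge (R + 1)
  -- Beyond `N` each step divides by a factor `n + 1 - z` of modulus at least `2`.
  refine ⟨∑ n ∈ Finset.range (N + 1), |c n| * 2 ^ n, fun n => ?_⟩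
  set C := ∑ n ∈ Finset.range (N + 1), |c n| * 2 ^ n
  have hsmall : ∀ n ≤ N, ∀ z ∈ Metric.closedBall (0 : ℂ) R,
      ‖(Complex.Gamma (n + 1 - z))⁻¹‖ ≤ C * (1 / 2) ^ n := by
    intro n hn z hz
    have h1 : |c n| * 2 ^ n ≤ C :=
      Finset.single_le_sum (f := fun n => |c n| * 2 ^ n) (fun i _ => by positivity)
        (Finset.mem_range.2 (Nat.lt_succ_of_le hn))
    calc _ ≤ |c n| := (hc n z hz).trans (le_abs_self _)
      _ = |c n| * 2 ^ n * (1 / 2) ^ n := by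
        rw [mul_assoc, ← mul_pow]; norm_num
      _ ≤ _ := by gcongr
  rcases le_or_gt n N with h | h
  · exact hsmall n h
  · induction n, h.le using Nat.le_induction with
    | base => exact hsmall N le_rfl
    | succ n hn ih =>
      intro z hz
      have ih' : ‖(Complex.Gamma (n + 1 - z))⁻¹‖ ≤ C * (1 / 2) ^ n := by
        rcases hn.eq_or_lt with h' | h'
        · exact hsmall n h'.ge z hz
        · exact ih h' z hz
      have hnorm : 2 ≤ ‖(n : ℂ) + 1 - z‖ := by
        have h1 : ‖z‖ ≤ R := by simpa using hz
        have h2 : ‖((n + 1 : ℕ) : ℂ)‖ - ‖z‖ ≤ ‖((n + 1 : ℕ) : ℂ) - z‖ := norm_sub_norm_le _ _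
        rw [Complex.norm_natCast] at h2
        push_cast at h2
        have h3 : (N : ℝ) ≤ n := by exact_mod_cast hn
        linarith
      have hne : (n : ℂ) + 1 - z ≠ 0 := norm_pos_iff.1 (by linarith)
      have e : ((n + 1 : ℕ) : ℂ) + 1 - z = (n + 1 - z) + 1 := by push_cast; ring
      rw [e, Complex.Gamma_add_one _ hne, mul_inv, norm_mul, norm_inv]
      calc _ ≤ 2⁻¹ * (C * (1 / 2) ^ n) := by gcongr
        _ = _ := by ring

/-- The entire factor `∑ εⁿ / Γ(n + 1 - z)` of the series `∑ (-ε)ⁿ Γ(z - n)`. -/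
noncomputable def invGammaSeries (ε : ℂ) (z : ℂ) : ℂ :=
  ∑' n : ℕ, ε ^ n * (Complex.Gamma (n + 1 - z))⁻¹

lemma summable_invGammaSeries {ε : ℂ} (hε : ‖ε‖ = 1) (z : ℂ) :
    Summable fun n : ℕ => ε ^ n * (Complex.Gamma (n + 1 - z))⁻¹ := by
  obtain ⟨C, hC⟩ := exists_bound_inv_Gamma ‖z‖
  refine Summable.of_norm_bounded (g := fun n => C * (1 / 2) ^ n)
    (summable_geometric_two.mul_left C) fun n => ?_
  rw [norm_mul, norm_pow, hε, one_pow, one_mul]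
  exact hC n z (by simp)

lemma differentiable_invGammaSeries {ε : ℂ} (hε : ‖ε‖ = 1) :
    Differentiable ℂ (invGammaSeries ε) := by
  intro z
  obtain ⟨C, hC⟩ := exists_bound_inv_Gamma (‖z‖ + 1)
  have h : DifferentiableOn ℂ (invGammaSeries ε) (Metric.ball 0 (‖z‖ + 1)) := by
    refine Complex.differentiableOn_tsum_of_summable_norm (u := fun n : ℕ => C * (1 / 2) ^ n)
      (summable_geometric_two.mul_left C) (fun n => ?_) Metric.isOpen_ball fun n w hw => ?_
    · exact ((Complex.differentiable_one_div_Gamma.comp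
        (by fun_prop : Differentiable ℂ fun z : ℂ => (n : ℂ) + 1 - z)).const_mul
          (ε ^ n)).differentiableOn
    · rw [norm_mul, norm_pow, hε, one_pow, one_mul]
      exact hC n w (Metric.ball_subset_closedBall hw)
  exact h.differentiableAt (Metric.isOpen_ball.mem_nhds (by simp))

lemma Complex.sin_pi_mul_ne_zero {z : ℂ} (hz : ∀ m : ℤ, z ≠ m) :
    Complex.sin (Real.pi * z) ≠ 0 := by
  rw [Complex.sin_ne_zero_iff]
  intro k hk
  have hpi : (Real.pi : ℂ) ≠ 0 := by exact_mod_cast Real.pi_ne_zero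
  rw [mul_comm (k : ℂ)] at hk
  exact hz k (mul_left_cancel₀ hpi hk)

/-- Reflection: the terms `Γ(z - n)` share the factor `π / sin (π z)`. -/
lemma Complex.Gamma_sub_nat {z : ℂ} (hz : ∀ m : ℤ, z ≠ m) (n : ℕ) :
    Complex.Gamma (z - n) = Real.pi / Complex.sin (Real.pi * z) *
      ((-1) ^ n * (Complex.Gamma (n + 1 - z))⁻¹) := by
  have h1 := Complex.Gamma_mul_Gamma_one_sub (z - n)
  have h2 : (1 : ℂ) - (z - n) = n + 1 - z := by ring
  have h3 : Complex.sin (Real.pi * (z - n)) = (-1) ^ n * Complex.sin (Real.pi * z) := by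
    rw [mul_sub, mul_comm (Real.pi : ℂ) n, Complex.sin_antiperiodic.sub_nat_mul_eq]
  have h4 : Complex.Gamma (n + 1 - z) ≠ 0 := by
    refine Complex.Gamma_ne_zero fun m hm => hz (n + 1 + m) ?_
    push_cast
    linear_combination -hm
  have h5 := Complex.sin_pi_mul_ne_zero hz
  have h6 : ((-1 : ℂ) ^ n) * (-1) ^ n = 1 := by rw [← mul_pow]; norm_num
  have h7 : ((-1 : ℂ) ^ n) ≠ 0 := pow_ne_zero _ (by norm_num)
  rw [h2, h3] at h1
  rw [eq_div_iff (mul_ne_zero h7 h5)] at h1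
  rw [div_mul_eq_mul_div, eq_div_iff h5, ← mul_assoc, eq_mul_inv_iff_mul_eq₀ h4]
  linear_combination ((-1) ^ n) * h1 -
    Complex.Gamma (z - n) * Complex.Gamma (n + 1 - z) * Complex.sin (Real.pi * z) * h6

/-- The series `∑ εⁿ Γ(z - n)`. -/
noncomputable def gammaSeries (ε : ℂ) (z : ℂ) : ℂ := ∑' n : ℕ, ε ^ n * Complex.Gamma (z - n)

lemma gammaSeries_term_eq {z : ℂ} (hz : ∀ m : ℤ, z ≠ m) (ε : ℂ) (n : ℕ) :
    ε ^ n * Complex.Gamma (z - n) = Real.pi / Complex.sin (Real.pi * z) *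
      ((-ε) ^ n * (Complex.Gamma (n + 1 - z))⁻¹) := by
  rw [Complex.Gamma_sub_nat hz, neg_pow ε]
  ring

lemma summable_gammaSeries {ε : ℂ} (hε : ‖ε‖ = 1) {z : ℂ} (hz : ∀ m : ℤ, z ≠ m) :
    Summable fun n : ℕ => ε ^ n * Complex.Gamma (z - n) := by
  simp only [gammaSeries_term_eq hz]
  exact (summable_invGammaSeries (by rwa [norm_neg]) z).mul_left _

lemma gammaSeries_eq (ε : ℂ) {z : ℂ} (hz : ∀ m : ℤ, z ≠ m) : gammaSeries ε z =
    Real.pi / Complex.sin (Real.pi * z) * invGammaSeries (-ε) z := by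
  simp only [gammaSeries, gammaSeries_term_eq hz, tsum_mul_left, invGammaSeries]

lemma differentiable_sin_pi_mul : Differentiable ℂ fun z : ℂ => Complex.sin (Real.pi * z) := by
  fun_prop

lemma meromorphic_sin_pi_mul : Meromorphic fun z : ℂ => Complex.sin (Real.pi * z) :=
  fun z => (differentiable_sin_pi_mul.analyticAt z).meromorphicAt

lemma eventually_ne_int : ∀ᶠ z : ℂ in codiscrete ℂ, ∀ m : ℤ, z ≠ m := by
  rcases meromorphic_sin_pi_mul.eventually_eq_zero_or_eventually_ne_zero with h | h
  · exfalso
    have h1 := eventually_codiscrete_iff.1 h (1 / 2)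
    have h2 : Tendsto (fun z : ℂ => Complex.sin (Real.pi * z)) (nhdsWithin (1 / 2) {1 / 2}ᶜ)
        (nhds (Complex.sin (Real.pi * (1 / 2)))) :=
      (differentiable_sin_pi_mul.continuous.tendsto _).mono_left nhdsWithin_le_nhds
    have h3 := tendsto_nhds_unique (h2.congr' h1) tendsto_const_nhds
    rw [mul_one_div, Complex.sin_pi_div_two] at h3
    exact one_ne_zero h3
  · refine h.mono fun z hz m hzm => hz ?_
    rw [hzm, mul_comm, Complex.sin_int_mul_pi]

lemma meromorphic_gammaSeries {ε : ℂ} (hε : ‖ε‖ = 1) : Meromorphic (gammaSeries ε) := by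
  have hE : Meromorphic (invGammaSeries (-ε)) := fun z =>
    ((differentiable_invGammaSeries (ε := -ε) (by rwa [norm_neg])).analyticAt z).meromorphicAt
  refine (((Meromorphic.const (Real.pi : ℂ)).div meromorphic_sin_pi_mul).mul hE).congr_codiscrete ?_
  exact eventually_ne_int.mono fun z hz => (gammaSeries_eq ε hz).symm

lemma gammaSeries_sub {ε : ℂ} (hε : ‖ε‖ = 1) {z : ℂ} (hz : ∀ m : ℤ, z ≠ m) :
    gammaSeries ε z - ε * gammaSeries ε (z - 1) = Complex.Gamma z := by
  rw [gammaSeries, (summable_gammaSeries hε hz).tsum_eq_zero_add, gammaSeries, ← tsum_mul_left]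
  simp only [pow_zero, Nat.cast_zero, sub_zero, one_mul]
  rw [add_sub_assoc, add_eq_left, sub_eq_zero]
  refine tsum_congr fun n => ?_
  rw [pow_succ', mul_assoc]
  push_cast
  ring_nf

end Series

/-! ### Continuation by a difference equation -/

section Continuation

/-- A function that is meromorphic on the right half-plane and satisfies there
`f(z + 1) - ε f(z) = g(z)` with `g` meromorphic on `ℂ` continues to `ℂ`: going left, the equation
determines `f(z)` from `f(z + 1)`. -/
lemma exists_meromorphicContinuation {f g : ℂ → ℂ} (hf : ∀ z : ℂ, 0 < z.re → MeromorphicAt f z)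
    (hg : Meromorphic g) {ε : ℂ} (hε : ε ≠ 0)
    (h : ∀ z : ℂ, 0 < z.re → f (z + 1) - ε * f z = g z) :
    ∃ F, IsMeromorphicContinuation f F := by
  -- `G n` is the continuation to `Re z > -n`.
  let G : ℕ → ℂ → ℂ := fun n => Nat.rec f (fun _ φ z => ε⁻¹ * (φ (z + 1) - g z)) n
  have hG : ∀ n z, G (n + 1) z = ε⁻¹ * (G n (z + 1) - g z) := fun _ _ => rfl
  have hmero : ∀ n : ℕ, ∀ z : ℂ, -(n : ℝ) < z.re → MeromorphicAt (G n) z := by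
    intro n
    induction n with
    | zero => exact fun z hz => hf z (by simpa using hz)
    | succ n ih =>
      intro z hz
      have h1 : MeromorphicAt (G n) (z + 1) := ih _ (by
        push_cast at hz
        simp only [Complex.add_re, Complex.one_re]
        linarith)
      have h2 : MeromorphicAt (fun w => G n (w + 1)) z :=
        h1.comp_analyticAt (g := fun w => w + 1) (by fun_prop)
      exact (MeromorphicAt.const ε⁻¹ z).mul (h2.sub (hg z))
  have hstep : ∀ n : ℕ, ∀ z : ℂ, -(n : ℝ) < z.re → G (n + 1) z = G n z := by
    intro n
    induction n with
    | zero =>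
      intro z hz
      rw [hG, inv_mul_eq_iff_eq_mul₀ hε]
      have := h z (by simpa using hz)
      change f (z + 1) - g z = ε * f z
      linear_combination this
    | succ n ih =>
      intro z hz
      have h1 := ih (z + 1) (by
        push_cast at hz
        simp only [Complex.add_re, Complex.one_re]
        linarith)
      rw [hG (n + 1), h1, hG]
  have hmono : ∀ n k : ℕ, ∀ z : ℂ, -(n : ℝ) < z.re → G (n + k) z = G n z := by
    intro n k z hz
    induction k with
    | zero => rfl
    | succ k ih =>
      rw [← add_assoc, hstep _ _ (by push_cast; linarith [(Nat.cast_nonneg k : (0 : ℝ) ≤ k)]), ih]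
  have heq : ∀ m n : ℕ, ∀ z : ℂ, -(m : ℝ) < z.re → -(n : ℝ) < z.re → G m z = G n z := by
    intro m n z hm hn
    rw [← hmono m n z hm, ← hmono n m z hn, add_comm]
  have hceil : ∀ z : ℂ, -((⌈|z.re|⌉₊ + 1 : ℕ) : ℝ) < z.re := by
    intro z
    have h1 := Nat.le_ceil |z.re|
    have h2 := neg_abs_le z.re
    push_cast
    linarith
  refine ⟨fun z => G (⌈|z.re|⌉₊ + 1) z, fun z => ?_, fun z hz => ?_⟩
  · refine (hmero _ z (hceil z)).congr (Eventually.filter_mono nhdsWithin_le_nhds ?_)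
    have hopen : IsOpen {w : ℂ | -((⌈|z.re|⌉₊ + 1 : ℕ) : ℝ) < w.re} :=
      isOpen_lt continuous_const Complex.continuous_re
    filter_upwards [hopen.mem_nhds (hceil z)] with w hw
    exact heq _ _ w hw (hceil w)
  · exact heq _ 0 z (hceil z) (by simpa using hz)

lemma isOpen_rightHalfPlane : IsOpen {z : ℂ | 0 < z.re} :=
  isOpen_lt continuous_const Complex.continuous_re

/-- By the identity theorem, a meromorphic continuation satisfies the difference equation. -/
lemma IsMeromorphicContinuation.difference_eq {f F g : ℂ → ℂ} (hF : IsMeromorphicContinuation f F)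
    (hg : Meromorphic g) {ε : ℂ} (h : ∀ z : ℂ, 0 < z.re → f (z + 1) - ε * f z = g z) :
    ∀ᶠ z in codiscrete ℂ, F (z + 1) - ε * F z = g z := by
  have hm : Meromorphic fun z => F (z + 1) - ε * F z - g z :=
    ((hF.1.comp_add 1).sub ((Meromorphic.const ε).mul hF.1)).sub hg
  refine (hm.eventually_eq_zero_of_eqOn isOpen_rightHalfPlane ⟨1, by simp⟩ fun z hz => ?_).mono
    fun z hz => sub_eq_zero.1 hz
  have hz' : 0 < z.re := hz
  rw [hF.2 z hz', hF.2 (z + 1) (by simp; linarith), h z hz', sub_self]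

end Continuation

/-! ### Kurepa's integral -/

section Kurepa

lemma kurepaIntegrand_sub {z : ℂ} {t : ℝ} (ht : 0 < t) (ht1 : t ≠ 1) :
    kurepaIntegrand (z + 1) t - kurepaIntegrand z t =
      (Real.exp (-t) : ℝ) * (t : ℂ) ^ (z + 1 - 1) := by
  have h0 : (t : ℂ) ≠ 0 := by exact_mod_cast ht.ne'
  have h1 : (t : ℂ) - 1 ≠ 0 := sub_ne_zero.2 (by exact_mod_cast ht1)
  rw [kurepaIntegrand, kurepaIntegrand, Complex.cpow_add _ _ h0, Complex.cpow_one,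
    add_sub_cancel_right]
  push_cast
  field_simp
  ring

/-- An integrable majorant for the `z`-derivative of Kurepa's integrand on `a ≤ Re z ≤ b`. -/
noncomputable def kurepaBound (a b t : ℝ) : ℝ := Real.exp (-t) * ((t ^ a + t ^ b) * (1 + t⁻¹))

lemma integrableOn_kurepaBound {a b : ℝ} (ha : 0 < a) (hb : 0 < b) :
    IntegrableOn (kurepaBound a b) (Set.Ioi 0) := by
  have h : ∀ s : ℝ, 0 < s → IntegrableOn
      (fun t : ℝ => Real.exp (-t) * (t ^ s * (1 + t⁻¹))) (Set.Ioi 0) := by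
    intro s hs
    have h1 := (Real.GammaIntegral_convergent (s := s + 1) (by linarith)).add
      (Real.GammaIntegral_convergent hs)
    refine h1.congr_fun (fun t ht => ?_) measurableSet_Ioi
    have ht' : (0 : ℝ) < t := ht
    simp only [Pi.add_apply, add_sub_cancel_right]
    rw [Real.rpow_sub_one ht'.ne']
    field_simp
  refine ((h a ha).add (h b hb)).congr_fun (fun t _ => ?_) measurableSet_Ioi
  simp only [Pi.add_apply, kurepaBound]
  ring

lemma abs_log_div_sub_one_le {t : ℝ} (ht : 0 < t) (ht1 : t ≠ 1) :
    |Real.log t / (t - 1)| ≤ 1 + t⁻¹ := by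
  have h1 := Real.log_le_sub_one_of_pos ht
  have h2 := Real.one_sub_inv_le_log_of_pos ht
  have h3 : 0 < t⁻¹ := inv_pos.2 ht
  rw [abs_div, div_le_iff₀ (abs_pos.2 (sub_ne_zero.2 ht1))]
  rcases lt_or_gt_of_ne ht1 with h | h
  · have hl : Real.log t < 0 := Real.log_neg ht h
    rw [abs_of_neg hl, abs_of_neg (by linarith)]
    have : t⁻¹ * t = 1 := inv_mul_cancel₀ ht.ne'
    nlinarith
  · have hl : 0 < Real.log t := Real.log_pos h
    rw [abs_of_pos hl, abs_of_pos (by linarith)]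
    nlinarith

/-- The `z`-derivative of Kurepa's integrand. -/
noncomputable def kurepaIntegrandDeriv (z : ℂ) (t : ℝ) : ℂ :=
  Complex.exp (-(t : ℂ)) * ((t : ℂ) ^ z * Complex.log t / ((t : ℂ) - 1))

lemma hasDerivAt_kurepaIntegrand {t : ℝ} (ht : 0 < t) (z : ℂ) :
    HasDerivAt (fun z => kurepaIntegrand z t) (kurepaIntegrandDeriv z t) z := by
  have h0 : (t : ℂ) ≠ 0 := by exact_mod_cast ht.ne'
  have h1 := ((hasDerivAt_id z).const_cpow (c := (t : ℂ)) (Or.inl h0)).sub_const 1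
  have h2 := (h1.div_const ((t : ℂ) - 1)).const_mul (Complex.exp (-(t : ℂ)))
  simpa [kurepaIntegrandDeriv, kurepaIntegrand] using h2

lemma norm_kurepaIntegrandDeriv_le {t : ℝ} (ht : 0 < t) (ht1 : t ≠ 1) {z : ℂ} {a b : ℝ}
    (ha : a ≤ z.re) (hb : z.re ≤ b) : ‖kurepaIntegrandDeriv z t‖ ≤ kurepaBound a b t := by
  have h1 : t ^ z.re ≤ t ^ a + t ^ b := by
    rcases le_total t 1 with h | h
    · exact (Real.rpow_le_rpow_of_exponent_ge ht h ha).trans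
        (le_add_of_nonneg_right (Real.rpow_nonneg ht.le b))
    · exact (Real.rpow_le_rpow_of_exponent_le h hb).trans
        (le_add_of_nonneg_left (Real.rpow_nonneg ht.le a))
  have h2 : ‖Complex.log t / ((t : ℂ) - 1)‖ ≤ 1 + t⁻¹ := by
    have := abs_log_div_sub_one_le ht ht1
    rw [← Complex.ofReal_log ht.le]
    rw [← Real.norm_eq_abs, ← Complex.norm_real] at this
    push_cast at this ⊢
    exact this
  have h3 : ‖Complex.exp (-(t : ℂ))‖ = Real.exp (-t) := by
    rw [Complex.norm_exp]; simp
  rw [kurepaIntegrandDeriv, mul_div_assoc, norm_mul, norm_mul, h3,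
    Complex.norm_cpow_eq_rpow_re_of_pos ht, kurepaBound]
  gcongr

lemma ae_ne_one : ∀ᵐ t ∂(volume.restrict (Set.Ioi (0 : ℝ))), 0 < t ∧ t ≠ 1 := by
  have h1 : ∀ᵐ t ∂(volume.restrict (Set.Ioi (0 : ℝ))), t ≠ 1 :=
    ae_restrict_of_ae (by simp [ae_iff])
  filter_upwards [h1, ae_restrict_mem measurableSet_Ioi] with t h1 h2
  exact ⟨h2, h1⟩

lemma measurable_kurepaIntegrand (z : ℂ) : Measurable (kurepaIntegrand z) := by
  unfold kurepaIntegrand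
  fun_prop

lemma measurable_kurepaIntegrandDeriv (z : ℂ) : Measurable (kurepaIntegrandDeriv z) := by
  unfold kurepaIntegrandDeriv
  fun_prop

lemma integrableOn_kurepaIntegrand {z : ℂ} (hz : 0 < z.re) :
    IntegrableOn (kurepaIntegrand z) (Set.Ioi 0) := by
  set a := min z.re 1
  set b := max z.re 1
  have ha : 0 < a := lt_min hz one_pos
  have hexp : IntegrableOn (fun t : ℝ => Real.exp (-t)) (Set.Ioi 0) := by
    simpa using Real.GammaIntegral_convergent (s := 1) one_pos
  have hb : IntegrableOn (fun t => kurepaBound a b t * ‖z - 1‖) (Set.Ioi 0) :=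
    (integrableOn_kurepaBound ha (one_pos.trans_le (le_max_right _ _))).mul_const _
  refine (hexp.add hb).mono' (measurable_kurepaIntegrand z).aestronglyMeasurable ?_
  filter_upwards [ae_ne_one] with t ht
  obtain ⟨ht, ht1⟩ := ht
  have hconv : Convex ℝ {w : ℂ | a ≤ w.re ∧ w.re ≤ b} :=
    (convex_halfSpace_re_ge a).inter (convex_halfSpace_re_le b)
  -- The mean value inequality on a strip that contains `1`, where the integrand is `exp (-t)`,
  -- avoids a separate discussion of the singularity at `t = 1`.
  have h1 := hconv.norm_image_sub_le_of_norm_hasDerivWithin_le (f := fun w => kurepaIntegrand w t)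
    (fun w _ => (hasDerivAt_kurepaIntegrand ht w).hasDerivWithinAt)
    (fun w hw => norm_kurepaIntegrandDeriv_le ht ht1 hw.1 hw.2)
    (x := 1) (y := z) ⟨min_le_right _ _, le_max_right _ _⟩ ⟨min_le_left _ _, le_max_left _ _⟩
  have h2 : kurepaIntegrand 1 t = (Real.exp (-t) : ℝ) := by
    have : (t : ℂ) - 1 ≠ 0 := sub_ne_zero.2 (by exact_mod_cast ht1)
    rw [kurepaIntegrand, Complex.cpow_one, div_self this]
    push_cast
    ring
  have h3 : ‖kurepaIntegrand 1 t‖ = Real.exp (-t) := by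
    rw [h2, Complex.norm_real, Real.norm_of_nonneg (Real.exp_nonneg _)]
  calc ‖kurepaIntegrand z t‖
    _ ≤ ‖kurepaIntegrand 1 t‖ + ‖kurepaIntegrand z t - kurepaIntegrand 1 t‖ :=
        norm_le_norm_add_norm_sub' _ _
    _ ≤ _ := by
        rw [h3]
        exact add_le_add_right h1 _

lemma differentiableAt_kurepaIntegral {z : ℂ} (hz : 0 < z.re) :
    DifferentiableAt ℂ kurepaIntegral z := by
  have hopen : IsOpen {w : ℂ | z.re / 2 < w.re ∧ w.re < z.re + 1} :=
    (isOpen_lt continuous_const Complex.continuous_re).inter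
      (isOpen_lt Complex.continuous_re continuous_const)
  refine (hasDerivAt_integral_of_dominated_loc_of_deriv_le
    (F := kurepaIntegrand) (F' := kurepaIntegrandDeriv) (bound := kurepaBound (z.re / 2) (z.re + 1))
    (hopen.mem_nhds ⟨by linarith, by linarith⟩)
    (.of_forall fun w => (measurable_kurepaIntegrand w).aestronglyMeasurable)
    (integrableOn_kurepaIntegrand hz) (measurable_kurepaIntegrandDeriv z).aestronglyMeasurable ?_
    (integrableOn_kurepaBound (by linarith) (by linarith)) ?_).2.differentiableAt
  · filter_upwards [ae_ne_one] with t ht w hw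
    exact norm_kurepaIntegrandDeriv_le ht.1 ht.2 hw.1.le hw.2.le
  · filter_upwards [ae_ne_one] with t ht w _
    exact hasDerivAt_kurepaIntegrand ht.1 w

lemma kurepaIntegral_difference {z : ℂ} (hz : 0 < z.re) :
    kurepaIntegral (z + 1) - 1 * kurepaIntegral z = Complex.Gamma (z + 1) := by
  have hz1 : 0 < (z + 1).re := by simp; linarith
  rw [one_mul, kurepaIntegral, kurepaIntegral, ← integral_sub (integrableOn_kurepaIntegrand hz1)
    (integrableOn_kurepaIntegrand hz), Complex.Gamma_eq_integral hz1, Complex.GammaIntegral]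
  refine integral_congr_ae ?_
  filter_upwards [ae_ne_one] with t ht
  exact kurepaIntegrand_sub ht.1 ht.2

end Kurepa

/-! ### The alternating integral -/

section AltKurepa

/-- The function whose Mellin transform gives the alternating Kurepa function. -/
noncomputable def altKurepaWeight (t : ℝ) : ℂ := Complex.exp (-(t : ℂ)) / ((t : ℂ) + 1)

lemma ofReal_add_one_ne_zero {t : ℝ} (ht : 0 ≤ t) : (t : ℂ) + 1 ≠ 0 := by
  exact_mod_cast (by linarith : t + 1 ≠ 0)

lemma continuousOn_altKurepaWeight : ContinuousOn altKurepaWeight (Set.Ici 0) := by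
  unfold altKurepaWeight
  exact ContinuousOn.div (by fun_prop) (by fun_prop) fun t ht => ofReal_add_one_ne_zero ht

lemma norm_altKurepaWeight_le {t : ℝ} (ht : 0 ≤ t) : ‖altKurepaWeight t‖ ≤ Real.exp (-1 * t) := by
  have h1 : ‖(t : ℂ) + 1‖ = t + 1 := by
    have : (t : ℂ) + 1 = ((t + 1 : ℝ) : ℂ) := by push_cast; rfl
    rw [this, Complex.norm_real, Real.norm_of_nonneg (by linarith)]
  have h2 : ‖Complex.exp (-(t : ℂ))‖ = Real.exp (-1 * t) := by
    rw [Complex.norm_exp]; simp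
  rw [altKurepaWeight, norm_div, h1, h2]
  exact div_le_self (Real.exp_nonneg _) (by linarith)

lemma locallyIntegrableOn_altKurepaWeight : LocallyIntegrableOn altKurepaWeight (Set.Ioi 0) :=
  (continuousOn_altKurepaWeight.mono Set.Ioi_subset_Ici_self).locallyIntegrableOn measurableSet_Ioi

lemma altKurepaWeight_isBigO_top :
    altKurepaWeight =O[atTop] fun t => Real.exp (-1 * t) :=
  Asymptotics.IsBigO.of_bound 1 <| (eventually_ge_atTop 0).mono fun t ht => by
    rw [one_mul, Real.norm_of_nonneg (Real.exp_nonneg _)]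
    exact norm_altKurepaWeight_le ht

lemma altKurepaWeight_isBigO_zero :
    altKurepaWeight =O[nhdsWithin 0 (Set.Ioi 0)] (· ^ (-(0 : ℝ))) :=
  Asymptotics.IsBigO.of_bound 1 <| eventually_mem_nhdsWithin.mono fun t ht => by
    have ht' : (0 : ℝ) < t := ht
    rw [neg_zero, Real.rpow_zero, norm_one, one_mul]
    exact (norm_altKurepaWeight_le ht'.le).trans (Real.exp_le_one_iff.2 (by linarith))

lemma mellinConvergent_altKurepaWeight {s : ℂ} (hs : 0 < s.re) :
    MellinConvergent altKurepaWeight s :=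
  mellinConvergent_of_isBigO_rpow_exp one_pos locallyIntegrableOn_altKurepaWeight
    altKurepaWeight_isBigO_top altKurepaWeight_isBigO_zero hs

lemma altKurepaIntegrand_eq (z : ℂ) (t : ℝ) : altKurepaIntegrand z t =
    (t : ℂ) ^ (z + 2 - 1) • altKurepaWeight t -
      (-1) ^ z * ((t : ℂ) ^ ((2 : ℂ) - 1) • altKurepaWeight t) := by
  have h1 : z + 2 - 1 = z + 1 := by ring
  have h2 : (2 : ℂ) - 1 = 1 := by norm_num
  rw [h1, h2, Complex.cpow_one, altKurepaIntegrand, altKurepaWeight, smul_eq_mul, smul_eq_mul]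
  ring

lemma integrableOn_altKurepaIntegrand {z : ℂ} (hz : 0 < z.re) :
    IntegrableOn (altKurepaIntegrand z) (Set.Ioi 0) := by
  have h1 := mellinConvergent_altKurepaWeight (s := z + 2) (by simp; linarith)
  have h2 := mellinConvergent_altKurepaWeight (s := 2) (by simp)
  exact (h1.sub (h2.const_mul ((-1) ^ z))).congr (.of_forall fun t =>
    (altKurepaIntegrand_eq z t).symm)

lemma altKurepaIntegral_eq {z : ℂ} (hz : 0 < z.re) : altKurepaIntegral z =
    mellin altKurepaWeight (z + 2) - (-1) ^ z * mellin altKurepaWeight 2 := by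
  have h1 := mellinConvergent_altKurepaWeight (s := z + 2) (by simp; linarith)
  have h2 := mellinConvergent_altKurepaWeight (s := 2) (by simp)
  rw [altKurepaIntegral, mellin, mellin, ← integral_const_mul, ← integral_sub h1
    (h2.const_mul ((-1) ^ z))]
  exact integral_congr_ae (.of_forall fun t => altKurepaIntegrand_eq z t)

lemma differentiableAt_altKurepaIntegral {z : ℂ} (hz : 0 < z.re) :
    DifferentiableAt ℂ altKurepaIntegral z := by
  have h1 : DifferentiableAt ℂ (mellin altKurepaWeight) (z + 2) :=
    mellin_differentiableAt_of_isBigO_rpow_exp one_pos locallyIntegrableOn_altKurepaWeight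
      altKurepaWeight_isBigO_top altKurepaWeight_isBigO_zero (by simp; linarith)
  have h2 : DifferentiableAt ℂ (fun w => mellin altKurepaWeight (w + 2)) z :=
    DifferentiableAt.comp (g := mellin altKurepaWeight) (f := fun w => w + 2) z h1 (by fun_prop)
  have h3 : DifferentiableAt ℂ (fun w : ℂ => (-1 : ℂ) ^ w) z :=
    differentiableAt_id.const_cpow (Or.inl (by norm_num))
  refine (h2.sub (h3.mul_const (mellin altKurepaWeight 2))).congr_of_eventuallyEq ?_
  filter_upwards [isOpen_rightHalfPlane.mem_nhds hz] with w hw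
  exact altKurepaIntegral_eq hw

lemma altKurepaIntegral_difference {z : ℂ} (hz : 0 < z.re) :
    altKurepaIntegral (z + 1) - (-1) * altKurepaIntegral z = Complex.Gamma (z + 2) := by
  have hz1 : 0 < (z + 1).re := by simp; linarith
  have hz2 : 0 < (z + 2).re := by simp; linarith
  rw [neg_one_mul, sub_neg_eq_add, altKurepaIntegral, altKurepaIntegral,
    ← integral_add (integrableOn_altKurepaIntegrand hz1) (integrableOn_altKurepaIntegrand hz),
    Complex.Gamma_eq_integral hz2, Complex.GammaIntegral]
  refine setIntegral_congr_fun measurableSet_Ioi fun t ht => ?_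
  have ht' : (0 : ℝ) < t := ht
  have h0 : (t : ℂ) ≠ 0 := by exact_mod_cast ht'.ne'
  have h1 := ofReal_add_one_ne_zero ht'.le
  have e1 : (-1 : ℂ) ^ (z + 1) = -(-1) ^ z := by
    rw [Complex.cpow_add _ _ (by norm_num), Complex.cpow_one]; ring
  have e2 : (t : ℂ) ^ (z + 1 + 1) = (t : ℂ) ^ (z + 1) * t := by
    rw [Complex.cpow_add _ _ h0, Complex.cpow_one]
  have e3 : z + 2 - 1 = z + 1 := by ring
  simp only [altKurepaIntegrand]
  rw [e1, e2, e3]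
  push_cast
  field_simp
  ring

end AltKurepa

/-! ### Differential transcendence of the Kurepa functions -/

theorem mainTheorem2 :
    -- every meromorphic solution of the functional equation
    (∀ F : ℂ → ℂ, IsKurepaSolution F → IsDiffTranscendental F) ∧
    -- Kurepa's function
    ((∀ z : ℂ, 0 < z.re → IntegrableOn (kurepaIntegrand z) (Set.Ioi 0)) ∧
      (∃ K : ℂ → ℂ, IsMeromorphicContinuation kurepaIntegral K) ∧
      (∀ K : ℂ → ℂ, IsMeromorphicContinuation kurepaIntegral K →
        IsKurepaSolution K ∧ IsDiffTranscendental K)) ∧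
    -- the series solution
    ((∀ z : ℂ, (∀ m : ℤ, z ≠ m) → Summable fun n : ℕ => Complex.Gamma (z - n)) ∧
      IsKurepaSolution kurepaSeries ∧ IsDiffTranscendental kurepaSeries) ∧
    -- the alternating Kurepa function
    ((∀ z : ℂ, 0 < z.re → IntegrableOn (altKurepaIntegrand z) (Set.Ioi 0)) ∧
      (∃ A : ℂ → ℂ, IsMeromorphicContinuation altKurepaIntegral A) ∧
      (∀ A : ℂ → ℂ, IsMeromorphicContinuation altKurepaIntegral A → IsDiffTranscendental A)) ∧
    -- the alternating series
    ((∀ z : ℂ, (∀ m : ℤ, z ≠ m) →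
        Summable fun n : ℕ => (-1) ^ n * Complex.Gamma (z + 1 - n)) ∧
      Meromorphic altKurepaSeries ∧ IsDiffTranscendental altKurepaSeries) := by
  have hΓ : ∀ c : ℂ, Meromorphic fun z => Complex.Gamma (z + c) := Meromorphic.Gamma.comp_add
  have hΓ1 : Meromorphic fun z => Complex.Gamma (z + 1) := hΓ 1
  have hΓ2 : ∀ᶠ z in codiscrete ℂ,
      Complex.Gamma (z + 2) =
        (Polynomial.X * (Polynomial.X + Polynomial.C 1) : Polynomial ℂ).eval z *
        Complex.Gamma z := by
    filter_upwards [Complex.Gamma_add_one_eventually,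
      Complex.Gamma_add_one_eventually.codiscrete_comp_add 1] with z h1 h2
    have e : z + 2 = z + 1 + 1 := by ring
    rw [e, h2, h1]
    simp
    ring
  have hq : (Polynomial.X * (Polynomial.X + Polynomial.C 1) : Polynomial ℂ) ≠ 0 :=
    mul_ne_zero Polynomial.X_ne_zero (Polynomial.X_add_C_ne_zero 1)
  have main : ∀ F : ℂ → ℂ, IsKurepaSolution F → IsDiffTranscendental F := by
    rintro F ⟨hF, h⟩
    refine isDiffTranscendental_of_difference_eq hF (-1) Polynomial.X_ne_zero ?_
    filter_upwards [h.codiscrete_comp_add 1, Complex.Gamma_add_one_eventually] with z h1 h2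
    rw [add_sub_cancel_right, h2] at h1
    rw [Polynomial.eval_X, ← h1]
    ring
  have hK : ∀ K : ℂ → ℂ, IsMeromorphicContinuation kurepaIntegral K → IsKurepaSolution K := by
    intro K hK
    refine ⟨hK.1, ?_⟩
    have h1 := hK.difference_eq hΓ1 fun z hz => kurepaIntegral_difference hz
    filter_upwards [h1.codiscrete_comp_add (-1)] with z hz
    simpa [sub_eq_add_neg] using hz
  have hseries : kurepaSeries = gammaSeries 1 := by
    funext z
    simp [kurepaSeries, gammaSeries]
  have haltSeries : altKurepaSeries = fun z => gammaSeries (-1) (z + 1) := rfl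
  have hs : IsKurepaSolution kurepaSeries := by
    rw [hseries]
    refine ⟨meromorphic_gammaSeries (by simp), eventually_ne_int.mono fun z hz => ?_⟩
    simpa using gammaSeries_sub (ε := 1) (by simp) hz
  have hshift : ∀ {z : ℂ} (k : ℤ), (∀ m : ℤ, z ≠ m) → ∀ m : ℤ, z + k ≠ m := fun {z} k hz m hm =>
    hz (m - k) (by push_cast; rw [← hm]; ring)
  have hmalt : Meromorphic altKurepaSeries := (meromorphic_gammaSeries (by simp)).comp_add 1
  refine ⟨main, ⟨fun z hz => integrableOn_kurepaIntegrand hz, ?_,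
      fun K h => ⟨hK K h, main K (hK K h)⟩⟩,
    ⟨fun z hz => ?_, hs, main _ hs⟩, ⟨fun z hz => integrableOn_altKurepaIntegrand hz, ?_, ?_⟩,
    fun z hz => ?_, hmalt, ?_⟩
  · refine exists_meromorphicContinuation (fun z hz => ?_) hΓ1 one_ne_zero
      fun z hz => kurepaIntegral_difference hz
    refine (DifferentiableOn.analyticAt (s := {z : ℂ | 0 < z.re}) (fun w hw => ?_)
      (isOpen_rightHalfPlane.mem_nhds hz)).meromorphicAt
    exact (differentiableAt_kurepaIntegral hw).differentiableWithinAt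
  · simpa using summable_gammaSeries (ε := 1) (by simp) hz
  · refine exists_meromorphicContinuation (fun z hz => ?_) (hΓ 2) (neg_ne_zero.2 one_ne_zero)
      fun z hz => altKurepaIntegral_difference hz
    refine (DifferentiableOn.analyticAt (s := {z : ℂ | 0 < z.re}) (fun w hw => ?_)
      (isOpen_rightHalfPlane.mem_nhds hz)).meromorphicAt
    exact (differentiableAt_altKurepaIntegral hw).differentiableWithinAt
  · intro A hA
    refine isDiffTranscendental_of_difference_eq hA.1 1 hq ?_
    filter_upwards [hA.difference_eq (hΓ 2) fun z hz => altKurepaIntegral_difference hz, hΓ2]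
      with z h1 h2
    rw [← h2, ← h1]
    ring
  · exact summable_gammaSeries (by simp) (by simpa using hshift 1 hz)
  · refine isDiffTranscendental_of_difference_eq hmalt 1 hq ?_
    filter_upwards [eventually_ne_int, hΓ2] with z hz h2
    have h1 := gammaSeries_sub (ε := -1) (by simp) (z := z + 2) (by simpa using hshift 2 hz)
    have e : z + 2 - 1 = z + 1 := by ring
    have e' : z + 1 + 1 = z + 2 := by ring
    rw [← h2, ← h1, haltSeries, e]
    simp only [e']
    ring
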